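/- **Setting.** Write $\mathbb{R}_+=[0,\infty)$. Let $X$ be a complex Banach space and let $T_1,\dots,T_n$ be one-parameter $C_0$-semigroups of bounded linear operators in $X$ that are bounded ($\sup_{t\ge 0}\|T_j(t)\|<\infty$) and commute pairwise ($T_i(s)T_j(t)=T_j(t)T_i(s)$ for all $i,j$ and $s,t\ge 0$). Let $A_j$ be the generator of $T_j$, $A=(A_1,\dots,A_n)$, $D(A)=\bigcap_j D(A_j)$, and $T(u)=T_1(u_1)\cdots T_n(u_n)$ for $u\in\mathbb{R}_+^n$. Let $\psi$ be a (negative) Bernstein function of $n$ variables: $\psi\in C^\infty((-\infty,0)^n)$, $\psi\le 0$, and every first-order partial derivative of $\psi$ is absolutely monotone, i.e. is nonnegative on $(-\infty,0)^n$ together with all its partial derivatives of all orders. Then $\psi$ has a unique representation $$\psi(s)=c_0+c_1\cdot s+\int_{\mathbb{R}_+^n\setminus\{0\}}(e^{s\cdot u}-1)\,d\mu(u)\qquad(s\in(-\infty,0)^n)$$ with $c_0\in\mathbb{R}$, $c_1\in\mathbb{R}_+^n$ and a positive measure $\mu$ on $\mathbb{R}_+^n\setminus\{0\}$; the same formula defines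 $\psi(\lambda)$ for $\lambda\in\mathbb{C}^n$ with $\operatorname{Re}\lambda_j\le 0$ for all $j$. For $t\ge 0$ let $\nu_t$ be the unique bounded positive measure on $\mathbb{R}_+^n$ with $\int e^{s\cdot u}\,d\nu_t(u)=e^{t\psi(s)}$ for $s\in(-\infty,0)^n$, and put $g_t(A)x=\int_{\mathbb{R}_+^n}T(u)x\,d\nu_t(u)$ (Bochner integral). The operator $\psi(A)$ is the generator of the semigroup $t\mapsto g_t(A)$. For a tuple $B=(B_1,\dots,B_k)$ of linear operators with domains in a Banach space $Y$: - $\sigma_p(B)$ is the set of $\lambda\in\mathbb{C}^k$ for which there is $y\in\bigcap_j D(B_j)$, $y\ne 0$ (a joint eigenvector for $\lambda$), with $B_jy=\lambda_jy$ for all $j$; - $\sigma_a(B)$ is the set of $\lambda\in\mathbb{C}^k$ for which there are $y_m\in\bigcap_j D(B_j)$ with $\|y_m\|=1$ and $\|B_jy_m-\lambda_jy_m\|\to 0$ as $m\to\infty$ for all $j$; - $\sigma_R(B)$ is the set of $\lambda\in\mathbb{C}^k$ for which $\sum_j\operatorname{Im}(\lambda_jI-B_j)$ is not dense in $Y$;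 - $\sigma_J(B)=\sigma_a(B)\cup\sigma_R(B)$. For a single operator these are its point, approximate point and residual spectra, and $\sigma$ denotes the usual spectrum. Let $A'=(A_1',\dots,A_n')$ be the tuple of the adjoint operators in the dual space $X'$. **Theorem.** The following inclusions hold: 1. $\sigma_R(\psi(A))\supseteq\psi(\sigma_R(A))$; 2. $\sigma_p(\psi(A))\supseteq\psi(\sigma_p(A))$; 3. if $\alpha\in\sigma_p(\psi(A))$ and there are an eigenvector $x$ of $\psi(A)$ for $\alpha$ and a joint eigenvector $f$ of $A'$ with $f(x)\neq 0$, then $\alpha\in\psi(\sigma_R(A))$. If in addition $\sigma_a(A_j)\subseteq\{z\in\mathbb{C}:\operatorname{Re}z<0\}$ for all $j$, or the limits $\dfrac{\partial\psi(-0)}{\partial s_j}=\lim_{s_1\to-0,\dots,s_n\to-0}\dfrac{\partial\psi}{\partial s_j}(s)$ are finite for all $j$, then also 4. $\sigma_a(\psi(A))\supseteq\psi(\sigma_a(A))$; 5. $\sigma(\psi(A))\supseteq\psi(\sigma_J(A))$. -/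

import Mathlib

open Filter Topology MeasureTheory
open scoped NNReal ContDiff

noncomputable section

namespace BochnerPhillips

/-! ### Bernstein functions of `n` variables -/

/-- The open negative orthant `(-∞; 0)ⁿ`. -/
def negOrthant (n : ℕ) : Set (Fin n → ℝ) := {s | ∀ j, s j < 0}

/-- The partial derivative of `f` with respect to the `j`-th variable. -/
def partialDeriv {n : ℕ} (j : Fin n) (f : (Fin n → ℝ) → ℝ) (s : Fin n → ℝ) : ℝ :=
  fderiv ℝ f s (Pi.single j 1)

/-- Absolutely monotone functions on `(-∞; 0)ⁿ`: smooth functions that are nonnegative together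
with all their partial derivatives of all orders (`k = 0` gives `f` itself). -/
def IsAbsolutelyMonotone {n : ℕ} (f : (Fin n → ℝ) → ℝ) : Prop :=
  ContDiffOn ℝ ∞ f (negOrthant n) ∧
    ∀ s ∈ negOrthant n, ∀ (k : ℕ) (i : Fin k → Fin n),
      0 ≤ iteratedFDeriv ℝ k f s (fun l => Pi.single (i l) 1)

/-- (Negative) Bernstein functions of `n` variables, the class `𝒯ₙ`: nonpositive smooth functions
on `(-∞; 0)ⁿ` all of whose first order partial derivatives are absolutely monotone.
The values of `ψ` outside `(-∞; 0)ⁿ` are irrelevant. -/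
def IsBernstein {n : ℕ} (ψ : (Fin n → ℝ) → ℝ) : Prop :=
  ContDiffOn ℝ ∞ ψ (negOrthant n) ∧ (∀ s ∈ negOrthant n, ψ s ≤ 0) ∧
    ∀ j, IsAbsolutelyMonotone (partialDeriv j ψ)

/-- The data `c₀`, `c₁ ∈ ℝ₊ⁿ` and a positive measure on `ℝ₊ⁿ` of an integral representation. -/
structure LevyData (n : ℕ) where
  c₀ : ℝ
  c₁ : Fin n → ℝ≥0
  μ : Measure (Fin n → ℝ≥0)

/-- `d` represents `ψ` on `(-∞; 0)ⁿ`: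
`ψ(s) = c₀ + c₁ · s + ∫ (e^{s·u} - 1) dμ(u)` with `μ` carried by `ℝ₊ⁿ ∖ {0}`. -/
def LevyData.Represents {n : ℕ} (d : LevyData n) (ψ : (Fin n → ℝ) → ℝ) : Prop :=
  d.μ {0} = 0 ∧
    ∀ s ∈ negOrthant n,
      Integrable (fun u : Fin n → ℝ≥0 => Real.exp (∑ j, s j * (u j : ℝ)) - 1) d.μ ∧
      ψ s = d.c₀ + ∑ j, (d.c₁ j : ℝ) * s j +
        ∫ u : Fin n → ℝ≥0, (Real.exp (∑ j, s j * (u j : ℝ)) - 1) ∂d.μ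

/-- The data of the (unique) integral representation of the Bernstein function `ψ`. -/
def levyData {n : ℕ} (ψ : (Fin n → ℝ) → ℝ) : LevyData n :=
  @Classical.epsilon _ ⟨⟨0, 0, 0⟩⟩ fun d => d.Represents ψ

/-- The extension of the Bernstein function `ψ` to `{z ∈ ℂⁿ : Re z_j ≤ 0 for all j}` by means of
its integral representation. -/
def bernsteinExtend {n : ℕ} (ψ : (Fin n → ℝ) → ℝ) (z : Fin n → ℂ) : ℂ :=
  ((levyData ψ).c₀ : ℂ) + ∑ j, (((levyData ψ).c₁ j : ℝ) : ℂ) * z j +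
    ∫ u : Fin n → ℝ≥0, (Complex.exp (∑ j, z j * ((u j : ℝ) : ℂ)) - 1) ∂(levyData ψ).μ

/-- The (unique) bounded positive measure `ν_t` on `ℝ₊ⁿ` whose Laplace transform is
`e^{tψ(s)}` on `(-∞; 0)ⁿ`. -/
def subordinator {n : ℕ} (ψ : (Fin n → ℝ) → ℝ) (t : ℝ≥0) : FiniteMeasure (Fin n → ℝ≥0) :=
  Classical.epsilon fun ν => ∀ s ∈ negOrthant n,
    ∫ u : Fin n → ℝ≥0, Real.exp (∑ j, s j * (u j : ℝ)) ∂(ν : Measure (Fin n → ℝ≥0)) =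
      Real.exp ((t : ℝ) * ψ s)

/-! ### Bounded semigroups and their generators -/

variable {X : Type*} [NormedAddCommGroup X] [NormedSpace ℂ X]

variable (X) in
/-- Bounded one-parameter `C₀`-semigroups of operators in `X`. -/
structure BoundedC0Semigroup where
  toFun : ℝ≥0 → X →L[ℂ] X
  map_zero : toFun 0 = 1
  map_add : ∀ s t, toFun (s + t) = toFun s * toFun t
  continuous_orbit : ∀ x, Continuous fun t => toFun t x
  bounded : ∃ M : ℝ, ∀ t, ‖toFun t‖ ≤ M

instance : CoeFun (BoundedC0Semigroup X) fun _ => ℝ≥0 → X →L[ℂ] X := ⟨BoundedC0Semigroup.toFun⟩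

/-- The graph of the generator of `G`: the pairs `(x, y)` with
`(G t x - x) / t → y` as `t → +0`. -/
def generatorGraph (G : ℝ≥0 → X →L[ℂ] X) : Submodule ℂ (X × X) where
  carrier := {p | Tendsto (fun t : ℝ≥0 => ((t : ℝ) : ℂ)⁻¹ • (G t p.1 - p.1)) (𝓝[>] 0) (𝓝 p.2)}
  zero_mem' := by simp
  add_mem' {p q} hp hq := by
    refine (Tendsto.add hp hq).congr fun t => ?_
    simp only [Prod.fst_add, map_add, ← smul_add]
    congr 1
    abel
  smul_mem' c p hp := by
    refine (Tendsto.const_smul hp c).congr fun t => ?_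
    simp only [Prod.smul_fst, map_smul, ← smul_sub]
    rw [smul_comm]

/-- The (infinitesimal) generator of a semigroup of operators `G`. -/
def generator (G : ℝ≥0 → X →L[ℂ] X) : X →ₗ.[ℂ] X := (generatorGraph G).toLinearPMap

/-- The tuple `A = (A₁, …, Aₙ)` of the generators of the semigroups `T₁, …, Tₙ`. -/
def generators {n : ℕ} (T : Fin n → BoundedC0Semigroup X) : Fin n → X →ₗ.[ℂ] X :=
  fun j => generator (T j)

/-- The operators `T(u) = T₁(u₁) ⋯ Tₙ(uₙ)`. -/
def multiSemigroup {n : ℕ} (T : Fin n → BoundedC0Semigroup X) (u : Fin n → ℝ≥0) : X →L[ℂ] X :=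
  (List.ofFn fun j => T j (u j)).prod

theorem BoundedC0Semigroup.continuous_uncurry (S : BoundedC0Semigroup X) :
    Continuous fun p : ℝ≥0 × X => S p.1 p.2 := by
  obtain ⟨M, hM⟩ := S.bounded
  refine continuous_prod_of_continuous_lipschitzWith' (fun p : ℝ≥0 × X => S p.1 p.2) M.toNNReal
    (fun t => ?_) fun x => S.continuous_orbit x
  refine (S t).lipschitz.weaken ?_
  rw [← NNReal.coe_le_coe]
  exact (hM t).trans (Real.le_coe_toNNReal M)

theorem multiSemigroup_continuous {n : ℕ} (T : Fin n → BoundedC0Semigroup X) (x : X) :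
    Continuous fun u => multiSemigroup T u x := by
  induction n with
  | zero => simpa [multiSemigroup] using continuous_const
  | succ n ih =>
    have h := (T 0).continuous_uncurry.comp
      ((continuous_apply (0 : Fin (n + 1))).prodMk
        ((ih (fun j => T j.succ)).comp
          (continuous_pi fun j : Fin n => continuous_apply (A := fun _ => ℝ≥0) j.succ)))
    refine h.congr fun u => ?_
    simp [multiSemigroup, List.ofFn_succ]

theorem multiSemigroup_bounded {n : ℕ} (T : Fin n → BoundedC0Semigroup X) :
    ∃ M : ℝ, 0 ≤ M ∧ ∀ u, ‖multiSemigroup T u‖ ≤ M := by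
  induction n with
  | zero => exact ⟨1, zero_le_one, fun u => by
      have h : multiSemigroup T u = ContinuousLinearMap.id ℂ X := by
        simp [multiSemigroup, ContinuousLinearMap.one_def]
      exact h ▸ ContinuousLinearMap.norm_id_le⟩
  | succ n ih =>
    obtain ⟨M, h0, hM⟩ := ih fun j => T j.succ
    obtain ⟨K, hK⟩ := (T 0).bounded
    have hK0 : 0 ≤ K := (norm_nonneg _).trans (hK 0)
    refine ⟨K * M, mul_nonneg hK0 h0, fun u => ?_⟩
    have : multiSemigroup T u =
        T 0 (u 0) * multiSemigroup (fun j => T j.succ) (fun j => u j.succ) := by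
      simp [multiSemigroup, List.ofFn_succ]
    rw [this]
    exact (norm_mul_le _ _).trans
      (mul_le_mul (hK _) (hM _) (norm_nonneg _) hK0)

theorem multiSemigroup_integrable {n : ℕ} (T : Fin n → BoundedC0Semigroup X)
    (ν : FiniteMeasure (Fin n → ℝ≥0)) (x : X) :
    Integrable (fun u => multiSemigroup T u x) (ν : Measure (Fin n → ℝ≥0)) := by
  obtain ⟨M, -, hM⟩ := multiSemigroup_bounded T
  exact Integrable.of_bound (multiSemigroup_continuous T x).aestronglyMeasurable (M * ‖x‖)
    (Eventually.of_forall fun u => (multiSemigroup T u).le_of_opNorm_le (hM u) x)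

/-- The operator `x ↦ ∫ T(u) x dν(u)` (Bochner integral). -/
def integralOperator {n : ℕ} (T : Fin n → BoundedC0Semigroup X)
    (ν : FiniteMeasure (Fin n → ℝ≥0)) : X →L[ℂ] X :=
  LinearMap.mkContinuousOfExistsBound
    { toFun := fun x => ∫ u, multiSemigroup T u x ∂(ν : Measure (Fin n → ℝ≥0))
      map_add' := fun x y => by
        simp only [map_add]
        exact integral_add (multiSemigroup_integrable T ν x) (multiSemigroup_integrable T ν y)
      map_smul' := fun c x => by
        simp only [map_smul, RingHom.id_apply]
        exact integral_smul c _ }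
    (by
      obtain ⟨M, -, hM⟩ := multiSemigroup_bounded T
      refine ⟨M * (ν : Measure (Fin n → ℝ≥0)).real Set.univ, fun x => ?_⟩
      refine (norm_integral_le_of_norm_le_const
        (Eventually.of_forall fun u => (multiSemigroup T u).le_of_opNorm_le (hM u) x)).trans ?_
      exact le_of_eq (by ring))

/-- The semigroup `g(A)`: `g_t(A) x = ∫ T(u) x dν_t(u)`. -/
def subordinateSemigroup {n : ℕ} (ψ : (Fin n → ℝ) → ℝ) (T : Fin n → BoundedC0Semigroup X)
    (t : ℝ≥0) : X →L[ℂ] X :=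
  integralOperator T (subordinator ψ t)

/-- The value `ψ(A)` of the Bochner–Phillips calculus at the tuple `A` of the generators of
`T₁, …, Tₙ`: the generator of the semigroup `g(A)`. -/
def bernsteinOperator {n : ℕ} (ψ : (Fin n → ℝ) → ℝ) (T : Fin n → BoundedC0Semigroup X) :
    X →ₗ.[ℂ] X :=
  generator (subordinateSemigroup ψ T)

/-! ### Spectra -/

/-- `x` is an eigenvector of `B` for the eigenvalue `α`. -/
def IsEigenvector (B : X →ₗ.[ℂ] X) (α : ℂ) (x : X) : Prop :=
  x ≠ 0 ∧ ∃ hx : x ∈ B.domain, B ⟨x, hx⟩ = α • x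

/-- `Im(α - B)`. -/
def rangeSub (B : X →ₗ.[ℂ] X) (α : ℂ) : Submodule ℂ X :=
  LinearMap.range (α • B.domain.subtype - B.toFun)

/-- The point spectrum of an operator. -/
def pointSpectrum (B : X →ₗ.[ℂ] X) : Set ℂ := {α | ∃ x, IsEigenvector B α x}

/-- The approximate point spectrum of an operator. -/
def approxSpectrum (B : X →ₗ.[ℂ] X) : Set ℂ :=
  {α | ∃ x : ℕ → B.domain, (∀ m, ‖(x m : X)‖ = 1) ∧
    Tendsto (fun m => ‖B (x m) - α • (x m : X)‖) atTop (𝓝 0)}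

/-- The residual spectrum of an operator: those `α` for which `Im(α - B)` is not dense. -/
def residualSpectrum (B : X →ₗ.[ℂ] X) : Set ℂ := {α | ¬ Dense (rangeSub B α : Set X)}

/-- The resolvent set of an operator: those `α` for which `α - B` has a bounded everywhere
defined inverse. -/
def opResolventSet (B : X →ₗ.[ℂ] X) : Set ℂ :=
  {α | ∃ R : X →L[ℂ] X,
    (∀ y, ∃ hy : R y ∈ B.domain, α • R y - B ⟨R y, hy⟩ = y) ∧
    ∀ x : B.domain, R (α • (x : X) - B x) = x}

/-- The spectrum of an operator. -/
def opSpectrum (B : X →ₗ.[ℂ] X) : Set ℂ := (opResolventSet B)ᶜ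

/-- `x` is a joint eigenvector of the tuple `A` for the joint eigenvalue `z`. -/
def IsJointEigenvector {n : ℕ} (A : Fin n → X →ₗ.[ℂ] X) (z : Fin n → ℂ) (x : X) : Prop :=
  x ≠ 0 ∧ ∀ j, ∃ hx : x ∈ (A j).domain, A j ⟨x, hx⟩ = z j • x

/-- The joint point spectrum of a tuple of operators. -/
def jointPointSpectrum {n : ℕ} (A : Fin n → X →ₗ.[ℂ] X) : Set (Fin n → ℂ) :=
  {z | ∃ x, IsJointEigenvector A z x}

/-- The joint approximate spectrum of a tuple of operators. -/
def jointApproxSpectrum {n : ℕ} (A : Fin n → X →ₗ.[ℂ] X) : Set (Fin n → ℂ) :=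
  {z | ∃ (x : ℕ → X) (hx : ∀ m j, x m ∈ (A j).domain), (∀ m, ‖x m‖ = 1) ∧
    ∀ j, Tendsto (fun m => ‖A j ⟨x m, hx m j⟩ - z j • x m‖) atTop (𝓝 0)}

/-- The joint residual spectrum of a tuple of operators: those `z` for which
`∑ j, Im(z_j - A_j)` is not dense. -/
def jointResidualSpectrum {n : ℕ} (A : Fin n → X →ₗ.[ℂ] X) : Set (Fin n → ℂ) :=
  {z | ¬ Dense ((⨆ j, rangeSub (A j) (z j) : Submodule ℂ X) : Set X)}

/-- The joint spectrum of a tuple of operators. -/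
def jointSpectrum {n : ℕ} (A : Fin n → X →ₗ.[ℂ] X) : Set (Fin n → ℂ) :=
  jointApproxSpectrum A ∪ jointResidualSpectrum A

/-! ### Adjoint operators -/

/-- The graph of the adjoint of `B`: the pairs `(f, g)` of functionals with `f(B x) = g(x)` for
all `x` in the domain of `B`. -/
def dualGraph (B : X →ₗ.[ℂ] X) : Submodule ℂ (StrongDual ℂ X × StrongDual ℂ X) where
  carrier := {p | ∀ x : B.domain, p.1 (B x) = p.2 (x : X)}
  zero_mem' := by simp
  add_mem' {p q} hp hq x := by simp [hp x, hq x]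
  smul_mem' c p hp x := by simp [hp x]

/-- The adjoint `B'` of a densely defined operator `B`, an operator in the dual space. -/
def dualOperator (B : X →ₗ.[ℂ] X) : StrongDual ℂ X →ₗ.[ℂ] StrongDual ℂ X :=
  (dualGraph B).toLinearPMap

end BochnerPhillips

end

open BochnerPhillips

/-!
The first step is a multivariate Bernstein theorem. Call a function on `(-∞; 0)ⁿ` absolutely
monotone when its backward differences `Δ_h f(s) = f(s) - f(s - h)` of all orders are nonnegative.
Such a function, if it is bounded and continuous, is the Laplace transform of a bounded positive
measure on `ℝ₊ⁿ` (`exists_finiteMeasure_laplace`). On a grid of width `ε`, multiplication of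
polynomials by `x_j` and `1 - x_j` corresponds to a shift and to a difference of `f`; the
functional `x^k ↦ f(s - εk)` is therefore nonnegative on the Bernstein polynomials. Hence the grid
values are almost the moments of a discrete measure on the cube, and a limit of these measures
exists by compactness.

The differences `Δ_h ψ` of a Bernstein function are absolutely monotone. So is `e^{tψ}`, since
`Δ_h e^{tψ} = e^{tψ(· - h)} (e^{t Δ_h ψ} - 1)`; this gives the measures `ν_t`. The measures of the
`Δ_h ψ` fit together, by uniqueness of Laplace transforms, and yield the representation of `ψ`
(`IsBernstein.exists_represents`). The identity theorem along complex lines, and a passage to the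
boundary, extend the defining property of `ν_t` to `∫ e^{z·u} dν_t(u) = e^{tψ(z)}` for
`Re z_j ≤ 0` (`IsBernstein.integral_cexpKernel`).

The spectral inclusions follow from this formula. If `x` is a joint eigenvector of `A` for `z`, then
`T(u)x = e^{z·u} x`, hence `g_t(A)x = e^{tψ(z)} x` by integration, and `ψ(A)x = ψ(z)x` by
differentiation at `t = 0`. Functionals `φ ≠ 0` with `φ(A_j x) = z_j φ(x)`, which describe the joint
residual spectrum (`mem_jointResidualSpectrum_iff`), are treated in the same way
(`apply_bernsteinOperator`); comparing the action of such a functional with that of an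
eigenvector of `ψ(A)` gives the third inclusion. For approximate eigenvectors `x_m`,
dominated convergence shows that `g_t(A)x_m - e^{tψ(z)} x_m → 0` for every `t`
(`tendsto_subordinateSemigroup_sub`). The averages `∫₀^τ g_s(A)x_m ds` lie in the domain of
`ψ(A)`, because `g_t(A)` is a `C₀`-semigroup (`subordinateC0Semigroup`), and `ψ(A)` maps them to
`g_τ(A)x_m - x_m`. For small `τ > 0` they are therefore, after normalization, approximate
eigenvectors of `ψ(A)` (`mem_approxSpectrum_generator`).
-/

namespace BochnerPhillips

/-! ### Functions with nonnegative iterated differences -/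

/-- The backward difference `s ↦ f(s) - f(s - h)`. -/
def backDiff {n : ℕ} (h : Fin n → ℝ) (f : (Fin n → ℝ) → ℝ) (s : Fin n → ℝ) : ℝ :=
  f s - f (s - h)

/-- All backward differences of `f` of order at most `k`, with steps in the closed positive
orthant, are nonnegative on `(-∞; 0)ⁿ`. -/
def DiffNonneg {n : ℕ} : ℕ → ((Fin n → ℝ) → ℝ) → Prop
  | 0, f => ∀ s ∈ negOrthant n, 0 ≤ f s
  | k + 1, f => (∀ s ∈ negOrthant n, 0 ≤ f s) ∧ ∀ h, 0 ≤ h → DiffNonneg k (backDiff h f)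

/-- Backward differences of all orders are nonnegative on `(-∞; 0)ⁿ`. This is absolute monotonicity
without smoothness, a notion that is stable under products and pointwise limits. -/
def DiffMonotone {n : ℕ} (f : (Fin n → ℝ) → ℝ) : Prop := ∀ k, DiffNonneg k f

variable {n : ℕ} {f g : (Fin n → ℝ) → ℝ} {s h : Fin n → ℝ} {k : ℕ}

theorem sub_mem_negOrthant (hs : s ∈ negOrthant n) (hh : 0 ≤ h) : s - h ∈ negOrthant n :=
  fun j => lt_of_le_of_lt (sub_le_self _ (hh j)) (hs j)

theorem isOpen_negOrthant : IsOpen (negOrthant n) := by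
  have : negOrthant n = ⋂ j, {s : Fin n → ℝ | s j < 0} := by ext; simp [negOrthant]
  rw [this]
  exact isOpen_iInter_of_finite fun j => isOpen_lt (continuous_apply j) continuous_const

theorem DiffNonneg.nonneg (hf : DiffNonneg k f) (hs : s ∈ negOrthant n) : 0 ≤ f s := by
  cases k with
  | zero => exact hf s hs
  | succ k => exact hf.1 s hs

theorem DiffNonneg.of_succ (hf : DiffNonneg (k + 1) f) : DiffNonneg k f := by
  induction k generalizing f with
  | zero => exact hf.1
  | succ k ih => exact ⟨hf.1, fun h hh => ih (hf.2 h hh)⟩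

theorem DiffNonneg.congr (hf : DiffNonneg k f) (hfg : Set.EqOn f g (negOrthant n)) :
    DiffNonneg k g := by
  induction k generalizing f g with
  | zero => exact fun s hs => hfg hs ▸ hf s hs
  | succ k ih =>
    refine ⟨fun s hs => hfg hs ▸ hf.1 s hs, fun h hh => ih (hf.2 h hh) fun s hs => ?_⟩
    simp only [backDiff, hfg hs, hfg (sub_mem_negOrthant hs hh)]

theorem DiffNonneg.shift (hf : DiffNonneg k f) (hh : 0 ≤ h) :
    DiffNonneg k fun s => f (s - h) := by
  induction k generalizing f with
  | zero => exact fun s hs => hf _ (sub_mem_negOrthant hs hh)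
  | succ k ih =>
    refine ⟨fun s hs => hf.1 _ (sub_mem_negOrthant hs hh), fun h' hh' => ?_⟩
    exact (ih (hf.2 h' hh')).congr fun s _ => by simp only [backDiff, sub_right_comm]

theorem DiffNonneg.add (hf : DiffNonneg k f) (hg : DiffNonneg k g) :
    DiffNonneg k fun s => f s + g s := by
  induction k generalizing f g with
  | zero => exact fun s hs => add_nonneg (hf s hs) (hg s hs)
  | succ k ih =>
    refine ⟨fun s hs => add_nonneg (hf.1 s hs) (hg.1 s hs), fun h hh => ?_⟩
    exact (ih (hf.2 h hh) (hg.2 h hh)).congr fun s _ => by simp only [backDiff]; ring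

/-- Stability under products: `Δ_h(fg) = Δ_h f · g + f(· - h) · Δ_h g`. -/
theorem DiffNonneg.mul (hf : DiffNonneg k f) (hg : DiffNonneg k g) :
    DiffNonneg k fun s => f s * g s := by
  induction k generalizing f g with
  | zero => exact fun s hs => mul_nonneg (hf s hs) (hg s hs)
  | succ k ih =>
    refine ⟨fun s hs => mul_nonneg (hf.1 s hs) (hg.1 s hs), fun h hh => ?_⟩
    exact ((ih (hf.2 h hh) hg.of_succ).add (ih (hf.of_succ.shift hh) (hg.2 h hh))).congr
      fun s _ => by simp only [backDiff]; ring

theorem diffNonneg_const {c : ℝ} (hc : 0 ≤ c) : DiffNonneg k fun _ : Fin n → ℝ => c := by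
  induction k generalizing c with
  | zero => exact fun _ _ => hc
  | succ k ih =>
    exact ⟨fun _ _ => hc, fun h _ => (ih le_rfl).congr fun s _ => by simp [backDiff]⟩

theorem diffNonneg_of_tendsto {F : ℕ → (Fin n → ℝ) → ℝ} (hF : ∀ m, DiffNonneg k (F m))
    (hlim : ∀ s ∈ negOrthant n, Tendsto (fun m => F m s) atTop (𝓝 (f s))) : DiffNonneg k f := by
  induction k generalizing f F with
  | zero => exact fun s hs => ge_of_tendsto' (hlim s hs) fun m => hF m s hs
  | succ k ih =>
    refine ⟨fun s hs => ge_of_tendsto' (hlim s hs) fun m => (hF m).1 s hs, fun h hh => ?_⟩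
    exact ih (fun m => (hF m).2 h hh) fun s hs =>
      (hlim s hs).sub (hlim _ (sub_mem_negOrthant hs hh))

theorem DiffMonotone.backDiff (hf : DiffMonotone f) (hh : 0 ≤ h) :
    DiffMonotone (backDiff h f) := fun k => (hf (k + 1)).2 h hh

theorem DiffMonotone.shift (hf : DiffMonotone f) (hh : 0 ≤ h) :
    DiffMonotone fun s => f (s - h) := fun k => (hf k).shift hh

theorem DiffMonotone.monotoneOn (hf : DiffMonotone f) : MonotoneOn f (negOrthant n) := by
  intro s hs s' hs' hss'
  have := (hf.backDiff (sub_nonneg.2 hss') 0).nonneg hs'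
  simpa [BochnerPhillips.backDiff] using this

/-- `e^g - 1 = ∑_{i ≥ 1} gⁱ / i!` inherits nonnegativity of differences from `g`. -/
theorem DiffNonneg.exp_sub_one (hg : DiffNonneg k g) :
    DiffNonneg k fun s => Real.exp (g s) - 1 := by
  have hpow : ∀ i, DiffNonneg k fun s => g s ^ i := fun i => by
    induction i with
    | zero => simpa using diffNonneg_const zero_le_one
    | succ i ih => simpa only [pow_succ] using ih.mul hg
  have hsum : ∀ N, DiffNonneg k fun s =>
      ∑ i ∈ Finset.range N, g s ^ (i + 1) / ((i + 1).factorial : ℝ) := fun N => by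
    induction N with
    | zero => simpa using diffNonneg_const le_rfl
    | succ N ih =>
      simp only [Finset.sum_range_succ, div_eq_mul_inv] at ih ⊢
      exact ih.add ((hpow _).mul (diffNonneg_const (by positivity)))
  refine diffNonneg_of_tendsto hsum fun s _ => ?_
  have h1 := (NormedSpace.expSeries_div_hasSum_exp (g s)).tendsto_sum_nat
  rw [← Real.exp_eq_exp_ℝ] at h1
  have h2 := ((tendsto_add_atTop_iff_nat 1).2 h1).sub_const 1
  refine h2.congr fun N => ?_
  rw [Finset.sum_range_succ']
  simp

/-- If all first differences of `g` are absolutely monotone, then so is `e^g`, since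
`Δ_h e^g = e^{g(· - h)} (e^{Δ_h g} - 1)`. -/
theorem diffMonotone_exp (hg : ∀ h, 0 ≤ h → DiffMonotone (backDiff h g)) :
    DiffMonotone fun s => Real.exp (g s) := by
  intro k
  induction k with
  | zero => exact fun s _ => (Real.exp_pos _).le
  | succ k ih =>
    refine ⟨fun s _ => (Real.exp_pos _).le, fun h hh => ?_⟩
    refine ((ih.shift hh).mul (hg h hh k).exp_sub_one).congr fun s _ => ?_
    simp only [backDiff, mul_sub, ← Real.exp_add, mul_one]
    congr 2
    ring

/-! ### Bernstein functions have absolutely monotone differences -/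

/-- A function with nonnegative partial derivatives is monotone on the negative orthant. -/
theorem le_of_fderiv_single_nonneg (hd : ∀ s ∈ negOrthant n, DifferentiableAt ℝ g s)
    (hg : ∀ s ∈ negOrthant n, ∀ j, 0 ≤ fderiv ℝ g s (Pi.single j 1))
    (hs : s ∈ negOrthant n) (hh : 0 ≤ h) : g (s - h) ≤ g s := by
  have hmem : ∀ r ∈ Set.Icc (0 : ℝ) 1, s - h + r • h ∈ negOrthant n := fun r hr j => by
    have h1 := hs j
    have h2 := hh j
    simp only [Pi.add_apply, Pi.sub_apply, Pi.smul_apply, smul_eq_mul, Pi.zero_apply] at *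
    nlinarith [mul_le_mul_of_nonneg_right hr.2 h2]
  have hder : ∀ r ∈ Set.Icc (0 : ℝ) 1, HasDerivAt (fun r : ℝ => g (s - h + r • h))
      (fderiv ℝ g (s - h + r • h) h) r := fun r hr => by
    have h1 : HasDerivAt (fun r : ℝ => s - h + r • h) h r := by
      simpa using ((hasDerivAt_id r).smul_const h).const_add (s - h)
    exact (hd _ (hmem r hr)).hasFDerivAt.comp_hasDerivAt r h1
  have hmono : MonotoneOn (fun r : ℝ => g (s - h + r • h)) (Set.Icc 0 1) := by
    refine monotoneOn_of_deriv_nonneg (convex_Icc 0 1)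
      (fun r hr => (hder r hr).continuousAt.continuousWithinAt)
      (fun r hr => (hder r (interior_subset hr)).differentiableAt.differentiableWithinAt)
      fun r hr => ?_
    rw [(hder r (interior_subset hr)).deriv]
    have h2 : h = ∑ j, h j • (Pi.single j 1 : Fin n → ℝ) := by
      ext i; simp [Finset.sum_apply, Pi.single_apply]
    rw [show fderiv ℝ g (s - h + r • h) h = fderiv ℝ g (s - h + r • h)
      (∑ j, h j • (Pi.single j 1 : Fin n → ℝ)) from congrArg _ h2, map_sum]
    exact Finset.sum_nonneg fun j _ => by
      rw [map_smul]
      exact smul_nonneg (hh j) (hg _ (hmem r (interior_subset hr)) j)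
  simpa using hmono (Set.left_mem_Icc.2 zero_le_one) (Set.right_mem_Icc.2 zero_le_one) zero_le_one

/-- A smooth function all of whose partial derivatives of order `k` are nonnegative. -/
def SmoothNonneg (k : ℕ) (f : (Fin n → ℝ) → ℝ) : Prop :=
  ContDiffOn ℝ ∞ f (negOrthant n) ∧ ∀ s ∈ negOrthant n, ∀ i : Fin k → Fin n,
    0 ≤ iteratedFDeriv ℝ k f s (fun l => Pi.single (i l) 1)

/-- A difference is an integral of first derivatives, so it uses up one derivative of `f`. -/
theorem SmoothNonneg.backDiff (hf : SmoothNonneg (k + 1) f) (hh : 0 ≤ h) :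
    SmoothNonneg k (backDiff h f) := by
  have hshift : ContDiffOn ℝ ∞ (fun s => f (s - h)) (negOrthant n) :=
    hf.1.comp (contDiffOn_id.sub contDiffOn_const) fun s hs => sub_mem_negOrthant hs hh
  have hat : ∀ {g : (Fin n → ℝ) → ℝ} {s}, ContDiffOn ℝ ∞ g (negOrthant n) →
      s ∈ negOrthant n → ContDiffAt ℝ ∞ g s := fun hg hs =>
    hg.contDiffAt (isOpen_negOrthant.mem_nhds hs)
  refine ⟨hf.1.sub hshift, fun s hs i => ?_⟩
  have h1 : iteratedFDeriv ℝ k (BochnerPhillips.backDiff h f) s =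
      iteratedFDeriv ℝ k f s - iteratedFDeriv ℝ k f (s - h) := by
    have := iteratedFDeriv_sub_apply (i := k) ((hat hf.1 hs).of_le (by exact_mod_cast le_top))
      ((hat hshift hs).of_le (by exact_mod_cast le_top))
    rw [iteratedFDeriv_comp_sub] at this
    exact this
  rw [h1, _root_.sub_apply, sub_nonneg]
  have hdiff : ∀ t ∈ negOrthant n, DifferentiableAt ℝ (iteratedFDeriv ℝ k f) t := fun t ht =>
    (hat hf.1 ht).differentiableAt_iteratedFDeriv (by exact_mod_cast ENat.natCast_lt_top k)
  refine le_of_fderiv_single_nonneg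
    (g := fun t => iteratedFDeriv ℝ k f t (fun l => Pi.single (i l) 1))
    (fun t ht => (hdiff t ht).continuousMultilinear_apply_const _) (fun t ht j => ?_) hs hh
  have h2 := hf.2 t ht (Fin.cons (α := fun _ => Fin n) j i)
  rw [(hdiff t ht).iteratedFDeriv_succ_apply_left'] at h2
  exact h2

theorem diffMonotone_of_smoothNonneg (hf : ∀ k, SmoothNonneg k f) : DiffMonotone f := by
  have hnn : ∀ {f : (Fin n → ℝ) → ℝ}, (∀ k, SmoothNonneg k f) → ∀ s ∈ negOrthant n, 0 ≤ f s :=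
    fun hf s hs => by simpa using (hf 0).2 s hs Fin.elim0
  intro k
  induction k generalizing f with
  | zero => exact hnn hf
  | succ k ih => exact ⟨hnn hf, fun h hh => ih fun k => (hf (k + 1)).backDiff hh⟩

theorem IsBernstein.smoothNonneg {ψ : (Fin n → ℝ) → ℝ} (hψ : IsBernstein ψ) (k : ℕ) :
    SmoothNonneg (k + 1) ψ := by
  refine ⟨hψ.1, fun s hs i => ?_⟩
  have h1 := (hψ.2.2 (i (Fin.last k))).2 s hs k (Fin.init (α := fun _ => Fin n) i)
  rw [iteratedFDeriv_succ_apply_right]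
  have h2 : ContDiffAt ℝ k (fderiv ℝ ψ) s :=
    (hψ.1.contDiffAt (isOpen_negOrthant.mem_nhds hs)).fderiv_right (m := k) (by
      exact_mod_cast le_top)
  have h3 := (ContinuousLinearMap.apply ℝ ℝ
    (Pi.single (i (Fin.last k)) 1 : Fin n → ℝ)).iteratedFDeriv_comp_left h2 (i := k) le_rfl
  have h4 : iteratedFDeriv ℝ k (partialDeriv (i (Fin.last k)) ψ) s = _ := h3
  rwa [h4] at h1

theorem IsBernstein.diffMonotone_backDiff {ψ : (Fin n → ℝ) → ℝ} (hψ : IsBernstein ψ)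
    (hh : 0 ≤ h) : DiffMonotone (backDiff h ψ) :=
  diffMonotone_of_smoothNonneg fun k => (hψ.smoothNonneg k).backDiff hh

end BochnerPhillips

namespace BochnerPhillips

/-! ### Sampling on a grid and Bernstein polynomials -/

variable {n : ℕ} {f : (Fin n → ℝ) → ℝ}

/-- The linear functional on polynomials that sends the monomial `x^k` to `f(s - εk)`, so that
multiplication by `x_j` corresponds to a shift of `f` and multiplication by `1 - x_j` to a backward
difference. -/
noncomputable def gridFunctional (f : (Fin n → ℝ) → ℝ) (s : Fin n → ℝ) (ε : ℝ) :
    MvPolynomial (Fin n) ℝ →ₗ[ℝ] ℝ :=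
  (MvPolynomial.basisMonomials (Fin n) ℝ).constr ℝ fun k => f (s - fun j => ε * (k j : ℝ))

theorem gridFunctional_monomial (s : Fin n → ℝ) (ε : ℝ) (k : Fin n →₀ ℕ) :
    gridFunctional f s ε (MvPolynomial.monomial k 1) = f (s - fun j => ε * (k j : ℝ)) := by
  rw [← show MvPolynomial.basisMonomials (Fin n) ℝ k = MvPolynomial.monomial k 1 from
    congrFun (MvPolynomial.coe_basisMonomials (Fin n) ℝ) k, gridFunctional,
    Module.Basis.constr_basis]

theorem gridFunctional_one (s : Fin n → ℝ) (ε : ℝ) : gridFunctional f s ε 1 = f s := by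
  rw [MvPolynomial.one_def, gridFunctional_monomial]
  congr 1
  ext j
  simp

theorem gridFunctional_prod_X_pow (s : Fin n → ℝ) (ε : ℝ) (m : Fin n → ℕ) :
    gridFunctional f s ε (∏ j, MvPolynomial.X j ^ m j) = f (s - fun j => ε * (m j : ℝ)) := by
  have : (∏ j, MvPolynomial.X j ^ m j : MvPolynomial (Fin n) ℝ) =
      MvPolynomial.monomial (Finsupp.equivFunOnFinite.symm m) 1 := by
    rw [MvPolynomial.monomial_eq, Finsupp.prod_fintype] <;> simp
  rw [this, gridFunctional_monomial]
  rfl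

theorem gridFunctional_X_mul (s : Fin n → ℝ) (ε : ℝ) (j : Fin n) (p : MvPolynomial (Fin n) ℝ) :
    gridFunctional f s ε (MvPolynomial.X j * p) =
      gridFunctional (fun t => f (t - Pi.single j ε)) s ε p := by
  have : (gridFunctional f s ε).comp (LinearMap.mulLeft ℝ (MvPolynomial.X j)) =
      gridFunctional (fun t => f (t - Pi.single j ε)) s ε := by
    refine (MvPolynomial.basisMonomials (Fin n) ℝ).ext fun k => ?_
    rw [MvPolynomial.coe_basisMonomials, gridFunctional_monomial, LinearMap.comp_apply,
      LinearMap.mulLeft_apply, MvPolynomial.X, MvPolynomial.monomial_mul, one_mul,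
      gridFunctional_monomial]
    congr 1
    ext i
    by_cases hi : i = j
    · subst hi; simp; ring
    · simp [Finsupp.single_apply, Ne.symm hi, hi]
  exact LinearMap.congr_fun this p

theorem gridFunctional_one_sub_X_mul (s : Fin n → ℝ) (ε : ℝ) (j : Fin n)
    (p : MvPolynomial (Fin n) ℝ) :
    gridFunctional f s ε ((1 - MvPolynomial.X j) * p) =
      gridFunctional (backDiff (Pi.single j ε) f) s ε p := by
  rw [sub_mul, one_mul, map_sub, gridFunctional_X_mul, ← LinearMap.sub_apply]
  refine LinearMap.congr_fun ((MvPolynomial.basisMonomials (Fin n) ℝ).ext fun k => ?_) p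
  simp only [MvPolynomial.coe_basisMonomials, LinearMap.sub_apply, gridFunctional_monomial,
    backDiff]

/-- The functional is nonnegative on the products of the factors `x_j` and `1 - x_j`, in particular
on the Bernstein polynomials. -/
theorem gridFunctional_nonneg (hf : DiffMonotone f) {s : Fin n → ℝ} (hs : s ∈ negOrthant n)
    {ε : ℝ} (hε : 0 ≤ ε) {p : MvPolynomial (Fin n) ℝ}
    (hp : p ∈ Submonoid.closure (Set.range (fun j : Fin n => (MvPolynomial.X j :
      MvPolynomial (Fin n) ℝ)) ∪ Set.range fun j => 1 - MvPolynomial.X j)) :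
    0 ≤ gridFunctional f s ε p := by
  induction hp using Submonoid.closure_induction_left generalizing f with
  | one => rw [gridFunctional_one]; exact (hf 0).nonneg hs
  | mul_left x hx y _ ih =>
    have hj : ∀ j : Fin n, (0 : Fin n → ℝ) ≤ Pi.single j ε := fun j => Pi.single_nonneg.2 hε
    obtain ⟨j, rfl⟩ | ⟨j, rfl⟩ := hx
    · simp only [gridFunctional_X_mul]
      exact ih (hf.shift (hj j))
    · simp only [gridFunctional_one_sub_X_mul]
      exact ih (hf.backDiff (hj j))

/-- The monomial `x^m` in terms of the Bernstein polynomials of degree `K`: its coefficients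
`C(k,m) / C(K,m)` are close to the values `(k/K)^m`. -/
theorem X_pow_eq_sum_bernsteinPolynomial {m K : ℕ} (hm : m ≤ K) :
    (Polynomial.X : Polynomial ℝ) ^ m = ∑ k ∈ Finset.range (K + 1),
      Polynomial.C ((k.choose m : ℝ) / K.choose m) * bernsteinPolynomial ℝ K k := by
  have hK : (K.choose m : ℝ) ≠ 0 := by exact_mod_cast (Nat.choose_pos hm).ne'
  obtain ⟨d, rfl⟩ := Nat.exists_eq_add_of_le hm
  have h1 : ∀ k ∈ Finset.range m, Polynomial.C ((k.choose m : ℝ) / (m + d).choose m) *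
      bernsteinPolynomial ℝ (m + d) k = 0 := fun k hk => by
    simp [Nat.choose_eq_zero_of_lt (Finset.mem_range.1 hk)]
  rw [add_assoc, Finset.sum_range_add, Finset.sum_eq_zero h1, zero_add]
  have h2 : ∀ i ∈ Finset.range (d + 1), Polynomial.C (((m + i).choose m : ℝ) /
      (m + d).choose m) * bernsteinPolynomial ℝ (m + d) (m + i) =
      Polynomial.X ^ m * bernsteinPolynomial ℝ d i := fun i hi => by
    have hi : i ≤ d := Nat.lt_succ_iff.1 (Finset.mem_range.1 hi)
    have h3 : ((m + d).choose (m + i) : ℝ) * (m + i).choose m = (m + d).choose m * d.choose i := by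
      have := Nat.choose_mul (n := m + d) (k := m + i) (s := m) (Nat.le_add_right m i)
      simp only [Nat.add_sub_cancel_left] at this
      exact_mod_cast this
    have h4 : ((m + i).choose m : ℝ) / (m + d).choose m * ((m + d).choose (m + i)) =
        d.choose i := by
      field_simp
      linarith
    simp only [bernsteinPolynomial, Nat.add_sub_add_left, ← Polynomial.C_eq_natCast, ← h4,
      Polynomial.C_mul, pow_add]
    ring
  rw [Finset.sum_congr rfl h2, ← Finset.mul_sum, bernsteinPolynomial.sum, mul_one]

theorem choose_div_choose_mem_Icc {m K k : ℕ} (hk : k ≤ K) :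
    (k.choose m : ℝ) / K.choose m ∈ Set.Icc (0 : ℝ) 1 :=
  ⟨by positivity, div_le_one_of_le₀ (by exact_mod_cast Nat.choose_le_choose m hk) (by positivity)⟩

theorem abs_choose_div_choose_sub_pow_le {m K k : ℕ} (hm : m ≤ K) (hk : k ≤ K) :
    |(k.choose m : ℝ) / K.choose m - ((k : ℝ) / K) ^ m| ≤ (m : ℝ) ^ 2 / K := by
  induction m with
  | zero => simp
  | succ m ih =>
    have hKm : (m : ℝ) + 1 ≤ K := by exact_mod_cast hm
    have hkK : (k : ℝ) ≤ K := by exact_mod_cast hk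
    have hm0 : (0 : ℝ) ≤ m := m.cast_nonneg
    have hk0 : (0 : ℝ) ≤ k := k.cast_nonneg
    have hK0 : (0 : ℝ) < K := by linarith
    have hd : (0 : ℝ) < K - m := by linarith
    have ih := ih (by omega)
    have hx : (k : ℝ) / K ∈ Set.Icc (0 : ℝ) 1 := ⟨by positivity, div_le_one_of_le₀ hkK hK0.le⟩
    set c := ((k.choose m : ℝ) / K.choose m)
    have hc : c ∈ Set.Icc (0 : ℝ) 1 := choose_div_choose_mem_Icc hk
    -- the successive quotients `(k - m) / (K - m)` differ from `k / K` by at most `m / K`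
    obtain ⟨q, hq, hqc⟩ : ∃ q : ℝ, |q - k / K| ≤ m / K ∧
        (k.choose (m + 1) : ℝ) / K.choose (m + 1) = c * q := by
      have hs : ∀ N : ℕ, m ≤ N → (N.choose (m + 1) : ℝ) = N.choose m * (N - m) / (m + 1) :=
        fun N hN => by
          have := Nat.choose_succ_right_eq N m
          rw [eq_div_iff (by positivity), ← Nat.cast_sub hN]
          exact_mod_cast this
      rcases le_or_gt m k with hmk | hmk
      · refine ⟨(k - m) / (K - m), ?_, ?_⟩
        · have hmk' : (m : ℝ) ≤ k := by exact_mod_cast hmk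
          have : ((k : ℝ) - m) / (K - m) - k / K = -(m / K * ((K - k) / (K - m))) := by
            field_simp; ring
          rw [this, abs_neg, abs_of_nonneg
            (mul_nonneg (by positivity) (div_nonneg (by linarith) hd.le))]
          exact mul_le_of_le_one_right (by positivity)
            (div_le_one_of_le₀ (by linarith) hd.le)
        · have : (K.choose m : ℝ) ≠ 0 := by
            exact_mod_cast (Nat.choose_pos (by omega)).ne'
          rw [hs k hmk, hs K (by omega)]
          simp only [c]
          field_simp
      · refine ⟨0, ?_, ?_⟩
        · rw [zero_sub, abs_neg, abs_of_nonneg hx.1]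
          have : (k : ℝ) ≤ m := by exact_mod_cast hmk.le
          gcongr
        · simp [Nat.choose_eq_zero_of_lt (hmk.trans (Nat.lt_succ_self m))]
    rw [hqc, pow_succ, show c * q - (k / K : ℝ) ^ m * (k / K) =
      c * (q - k / K) + (c - (k / K) ^ m) * (k / K) by ring]
    calc _ ≤ |c * (q - k / K)| + |(c - (k / K : ℝ) ^ m) * (k / K)| := abs_add_le _ _
      _ ≤ 1 * (m / K) + (m : ℝ) ^ 2 / K * 1 := by
        rw [abs_mul, abs_mul, abs_of_nonneg hc.1, abs_of_nonneg hx.1]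
        gcongr
        exacts [hc.2, hx.2]
      _ ≤ _ := by
        rw [one_mul, mul_one, ← add_div]
        push_cast
        gcongr
        nlinarith

theorem abs_prod_sub_prod_le {ι : Type*} (t : Finset ι) (a b e : ι → ℝ)
    (ha : ∀ i ∈ t, a i ∈ Set.Icc (0 : ℝ) 1) (hb : ∀ i ∈ t, b i ∈ Set.Icc (0 : ℝ) 1)
    (h : ∀ i ∈ t, |a i - b i| ≤ e i) : |∏ i ∈ t, a i - ∏ i ∈ t, b i| ≤ ∑ i ∈ t, e i := by
  classical
  induction t using Finset.induction_on with
  | empty => simp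
  | insert i t hi ih =>
    have hmem : ∀ j ∈ t, j ∈ insert i t := fun j hj => Finset.mem_insert_of_mem hj
    have ih := ih (fun j hj => ha j (hmem j hj)) (fun j hj => hb j (hmem j hj))
      fun j hj => h j (hmem j hj)
    rw [Finset.prod_insert hi, Finset.prod_insert hi, Finset.sum_insert hi]
    have hi' := Finset.mem_insert_self i t
    have hp0 : 0 ≤ ∏ j ∈ t, a j := Finset.prod_nonneg fun j hj => (ha j (hmem j hj)).1
    have hp1 : ∏ j ∈ t, a j ≤ 1 :=
      Finset.prod_le_one (fun j hj => (ha j (hmem j hj)).1) fun j hj => (ha j (hmem j hj)).2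
    rw [show a i * ∏ j ∈ t, a j - b i * ∏ j ∈ t, b j =
      (a i - b i) * ∏ j ∈ t, a j + b i * (∏ j ∈ t, a j - ∏ j ∈ t, b j) by ring]
    refine (abs_add_le _ _).trans ?_
    rw [abs_mul, abs_mul, abs_of_nonneg hp0, abs_of_nonneg (hb i hi').1]
    refine add_le_add ?_ ?_
    · exact (mul_le_of_le_one_right (abs_nonneg _) hp1).trans (h i hi')
    · exact (mul_le_of_le_one_left (abs_nonneg _) (hb i hi').2).trans ih

/-- The values `f(s - εm)` are, up to a small error, the moments of a discrete measure carried by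
the points `k / K` of the unit cube. -/
theorem exists_weights_moments (hf : DiffMonotone f) {s : Fin n → ℝ} (hs : s ∈ negOrthant n)
    {ε : ℝ} (hε : 0 ≤ ε) (K : ℕ) :
    ∃ w : (Fin n → ℕ) → ℝ, (∀ k, 0 ≤ w k) ∧
      ∑ k ∈ Fintype.piFinset fun _ : Fin n => Finset.range (K + 1), w k = f s ∧
      ∀ m : Fin n → ℕ, (∀ j, m j ≤ K) →
        |f (s - fun j => ε * (m j : ℝ)) -
          ∑ k ∈ Fintype.piFinset fun _ : Fin n => Finset.range (K + 1),
            w k * ∏ j, ((k j : ℝ) / K) ^ m j| ≤ f s * ∑ j, (m j : ℝ) ^ 2 / K := by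
  let B : (Fin n → ℕ) → MvPolynomial (Fin n) ℝ := fun k =>
    ∏ j, Polynomial.aeval (MvPolynomial.X j) (bernsteinPolynomial ℝ K (k j))
  have hexp : ∀ m : Fin n → ℕ, (∀ j, m j ≤ K) →
      f (s - fun j => ε * (m j : ℝ)) =
        ∑ k ∈ Fintype.piFinset fun _ : Fin n => Finset.range (K + 1),
          gridFunctional f s ε (B k) * ∏ j, (((k j).choose (m j) : ℝ) / K.choose (m j)) := by
    intro m hm
    have h1 : (∏ j, MvPolynomial.X j ^ m j : MvPolynomial (Fin n) ℝ) =
        ∑ k ∈ Fintype.piFinset fun _ : Fin n => Finset.range (K + 1),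
          (∏ j, (((k j).choose (m j) : ℝ) / K.choose (m j))) • B k := by
      have h2 : ∀ j : Fin n, (MvPolynomial.X j ^ m j : MvPolynomial (Fin n) ℝ) =
          ∑ k ∈ Finset.range (K + 1), (((k.choose (m j) : ℝ) / K.choose (m j))) •
            Polynomial.aeval (MvPolynomial.X j) (bernsteinPolynomial ℝ K k) := fun j => by
        have h3 := congrArg (Polynomial.aeval (MvPolynomial.X j : MvPolynomial (Fin n) ℝ))
          (X_pow_eq_sum_bernsteinPolynomial (hm j))
        rw [map_pow, Polynomial.aeval_X, map_sum] at h3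
        rw [h3]
        refine Finset.sum_congr rfl fun k _ => ?_
        rw [map_mul, Polynomial.aeval_C, Algebra.smul_def]
      rw [Finset.prod_congr rfl fun j _ => h2 j, Finset.prod_univ_sum]
      refine Finset.sum_congr rfl fun k _ => ?_
      rw [Finset.prod_smul]
    rw [← gridFunctional_prod_X_pow (f := f), h1, map_sum]
    refine Finset.sum_congr rfl fun k _ => ?_
    rw [map_smul, smul_eq_mul, mul_comm]
  have hw : ∀ k, 0 ≤ gridFunctional f s ε (B k) := by
    intro k
    have h1 : B k = (∏ j, (K.choose (k j) : ℝ)) •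
        ∏ j, (MvPolynomial.X j ^ (k j) * (1 - MvPolynomial.X j) ^ (K - k j)) := by
      rw [← Finset.prod_smul]
      refine Finset.prod_congr rfl fun j _ => ?_
      simp [bernsteinPolynomial, Algebra.smul_def, mul_assoc]
    rw [h1, map_smul]
    refine smul_nonneg (Finset.prod_nonneg fun j _ => Nat.cast_nonneg _)
      (gridFunctional_nonneg hf hs hε ?_)
    refine Submonoid.prod_mem _ fun j _ => Submonoid.mul_mem _ (Submonoid.pow_mem _ ?_ _)
      (Submonoid.pow_mem _ ?_ _)
    · exact Submonoid.subset_closure (Or.inl ⟨j, rfl⟩)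
    · exact Submonoid.subset_closure (Or.inr ⟨j, rfl⟩)
  have hsum : ∑ k ∈ Fintype.piFinset fun _ : Fin n => Finset.range (K + 1),
      gridFunctional f s ε (B k) = f s := by
    have := hexp 0 fun j => Nat.zero_le K
    simp only [Pi.zero_apply, Nat.choose_zero_right, Nat.cast_one, div_one,
      Finset.prod_const_one, mul_one, Nat.cast_zero, mul_zero] at this
    rw [← this]
    exact congrArg f (sub_zero s)
  refine ⟨_, hw, hsum, fun m hm => ?_⟩
  rw [hexp m hm, ← Finset.sum_sub_distrib, ← hsum, Finset.sum_mul]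
  refine (Finset.abs_sum_le_sum_abs _ _).trans (Finset.sum_le_sum fun k hk => ?_)
  have hk : ∀ j, k j ≤ K := fun j =>
    Nat.lt_succ_iff.1 (Finset.mem_range.1 (Fintype.mem_piFinset.1 hk j))
  rw [← mul_sub, abs_mul, abs_of_nonneg (hw k)]
  refine mul_le_mul_of_nonneg_left ?_ (hw k)
  refine abs_prod_sub_prod_le _ _ _ _ (fun j _ => choose_div_choose_mem_Icc (hk j))
    (fun j _ => ?_) fun j _ => abs_choose_div_choose_sub_pow_le (hm j) (hk j)
  have : (k j : ℝ) / K ∈ Set.Icc (0 : ℝ) 1 :=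
    ⟨by positivity, div_le_one_of_le₀ (by exact_mod_cast hk j) (by positivity)⟩
  exact ⟨pow_nonneg this.1 _, pow_le_one₀ this.1 this.2⟩

end BochnerPhillips

namespace BochnerPhillips

/-! ### Bernstein's theorem for absolutely monotone functions of several variables -/

variable {n : ℕ} {f : (Fin n → ℝ) → ℝ}

/-- The functions `y ↦ ∏ j, y_j ^ s_j` on the unit cube. -/
noncomputable def cubePow (s : Fin n → ℝ) (y : Fin n → unitInterval) : ℝ :=
  ∏ j, (y j : ℝ) ^ s j

theorem continuous_cubePow {s : Fin n → ℝ} (hs : ∀ j, 0 < s j) : Continuous (cubePow s) :=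
  continuous_finsetProd _ fun j _ =>
    (continuous_subtype_val.comp (continuous_apply j)).rpow_const fun _ => Or.inr (hs j).le

theorem exists_discrete_finiteMeasure {ι : Type*} {E : Type*} [MeasurableSpace E]
    (t : Finset ι) (w : ι → ℝ) (hw : ∀ k, 0 ≤ w k) (y : ι → E) :
    ∃ ρ : FiniteMeasure E, (ρ.mass : ℝ) = ∑ k ∈ t, w k ∧
      ∀ F : E → ℝ, StronglyMeasurable F →
        ∫ x, F x ∂(ρ : Measure E) = ∑ k ∈ t, w k * F (y k) := by
  let ν : Measure E := ∑ k ∈ t, ENNReal.ofReal (w k) • Measure.dirac (y k)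
  have hint : ∀ F : E → ℝ, StronglyMeasurable F → ∫ x, F x ∂ν = ∑ k ∈ t, w k * F (y k) := by
    intro F hF
    rw [integral_finsetSum_measure]
    · refine Finset.sum_congr rfl fun k _ => ?_
      rw [integral_smul_measure, integral_dirac' _ _ hF, ENNReal.toReal_ofReal (hw k), smul_eq_mul]
    · exact fun k _ => (integrable_dirac' hF (by simp)).smul_measure ENNReal.ofReal_ne_top
  have hfin : IsFiniteMeasure ν := by
    refine ⟨?_⟩
    simp [ν]
  refine ⟨⟨ν, hfin⟩, ?_, hint⟩
  have := hint (fun _ => 1) stronglyMeasurable_const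
  simp only [integral_const, smul_eq_mul, mul_one] at this
  exact this

theorem tendsto_natCast_succ_atTop : Tendsto (fun M : ℕ => ((M + 1 : ℕ) : ℝ)) atTop atTop :=
  tendsto_natCast_atTop_atTop.comp (tendsto_add_atTop_nat 1)

/-- The measure on the cube is obtained by compactness from discrete measures that
interpolate `f` on the grids of width `1/N`. The total masses stay bounded as `f` is bounded; mass
may escape to the faces `y_j = 0`, but these are not seen by `∏ j, y_j ^ s_j` for `s > 0`. -/
theorem exists_finiteMeasure_cube (hf : DiffMonotone f) (hc : ContinuousOn f (negOrthant n))
    {C : ℝ} (hC : ∀ s ∈ negOrthant n, f s ≤ C) :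
    ∃ ρ : FiniteMeasure (Fin n → unitInterval), ∀ s : Fin n → ℝ, (∀ j, 0 < s j) →
      ∫ y, cubePow s y ∂(ρ : Measure (Fin n → unitInterval)) = f (-s) := by
  -- grids of width `1 / N` with origin `(-1/N, …, -1/N)`, where `N = M + 1`
  let b : ℕ → Fin n → ℝ := fun M _ => -(1 / ((M + 1 : ℕ) : ℝ))
  have hb : ∀ M, b M ∈ negOrthant n := fun M j => neg_lt_zero.2 (by positivity)
  have hC0 : 0 ≤ C := ((hf 0).nonneg (hb 0)).trans (hC _ (hb 0))
  choose w hw0 hwsum hw using fun M : ℕ => exists_weights_moments hf (hb M)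
    (ε := 1 / ((M + 1 : ℕ) : ℝ)) (by positivity) ((M + 1) ^ 3)
  -- the degree `N³` dominates the squares of the orders `≈ s N` of the moments; the `N`-th powers
  -- turn the moment of order `s N` into the integral of `y^s`
  let pt : ℕ → (Fin n → ℕ) → Fin n → unitInterval := fun M k j =>
    Set.projIcc 0 1 zero_le_one (((k j : ℝ) / ((M + 1) ^ 3 : ℕ)) ^ (M + 1))
  choose ρ hρmass hρ using fun M : ℕ => exists_discrete_finiteMeasure
    (Fintype.piFinset fun _ : Fin n => Finset.range ((M + 1) ^ 3 + 1)) (w M) (hw0 M) (pt M)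
  obtain ⟨ρ₀, -, hρ₀⟩ := (isCompact_setOfPred_finiteMeasure_le_of_compactSpace
    (Fin n → unitInterval) C.toNNReal).ultrafilter_le_nhds ((hyperfilter ℕ).map ρ) (by
      refine le_principal_iff.2 (Filter.mem_map.2 (Eventually.of_forall fun M => ?_))
      change (ρ M).mass ≤ C.toNNReal
      rw [← NNReal.coe_le_coe, hρmass, hwsum, Real.coe_toNNReal _ hC0]
      exact hC _ (hb M))
  have hρ₀ : Tendsto ρ (hyperfilter ℕ) (𝓝 ρ₀) := hρ₀
  refine ⟨ρ₀, fun s hs => ?_⟩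
  have hlim₁ : Tendsto (fun M => ∫ y, cubePow s y ∂(ρ M : Measure (Fin n → unitInterval)))
      (hyperfilter ℕ) (𝓝 (∫ y, cubePow s y ∂(ρ₀ : Measure (Fin n → unitInterval)))) :=
    (FiniteMeasure.tendsto_iff_forall_integral_tendsto.1 hρ₀)
      (BoundedContinuousFunction.mkOfCompact ⟨cubePow s, continuous_cubePow hs⟩)
  have hsO : -s ∈ negOrthant n := fun j => neg_lt_zero.2 (hs j)
  have hcont : ContinuousAt f (-s) := hc.continuousAt (isOpen_negOrthant.mem_nhds hsO)
  -- the error of the moments of order about `s N` on the grid of width `1 / N`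
  let err : ℕ → ℝ := fun M =>
    C * ∑ j, (s j * ((M + 1 : ℕ) : ℝ) + 1) ^ 2 / (((M + 1) ^ 3 : ℕ) : ℝ)
  have herr : Tendsto err atTop (𝓝 0) := by
    have h1 : ∀ j, Tendsto (fun M : ℕ => (s j * ((M + 1 : ℕ) : ℝ) + 1) ^ 2 /
        (((M + 1) ^ 3 : ℕ) : ℝ)) atTop (𝓝 0) := fun j => by
      have h2 : Tendsto (fun M : ℕ => (((M + 1 : ℕ) : ℝ))⁻¹) atTop (𝓝 0) :=
        tendsto_inv_atTop_zero.comp tendsto_natCast_succ_atTop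
      have h3 : Tendsto (fun M : ℕ => (s j + (((M + 1 : ℕ) : ℝ))⁻¹) ^ 2 *
        (((M + 1 : ℕ) : ℝ))⁻¹) atTop (𝓝 0) := by
        simpa using (h2.const_add (s j)).pow 2 |>.mul h2
      refine h3.congr fun M => ?_
      push_cast
      field_simp
    have := (tendsto_finsetSum Finset.univ fun j _ => h1 j).const_mul C
    simpa [err] using this
  have hbd : ∀ᶠ M : ℕ in atTop, ∀ j, s j * ((M + 1 : ℕ) : ℝ) + 1 ≤ (((M + 1) ^ 3 : ℕ) : ℝ) := by
    rw [eventually_all]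
    intro j
    filter_upwards [tendsto_natCast_succ_atTop.eventually_ge_atTop (s j + 1)] with M hM
    have h1 : (1 : ℝ) ≤ ((M + 1 : ℕ) : ℝ) := by exact_mod_cast Nat.le_add_left 1 M
    push_cast at *
    nlinarith [hs j, mul_nonneg (sub_nonneg.2 h1) (sub_nonneg.2 hM),
      mul_nonneg (mul_nonneg (sub_nonneg.2 h1) (sub_nonneg.2 h1)) (sub_nonneg.2 h1)]
  -- evaluation of `f` at grid points close to `-s`
  have hgrid : ∀ m : ℕ → Fin n → ℕ,
      (∀ j, Tendsto (fun M => (m M j : ℝ) / ((M + 1 : ℕ) : ℝ)) atTop (𝓝 (s j))) →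
      Tendsto (fun M => f (b M - fun j => 1 / ((M + 1 : ℕ) : ℝ) * (m M j : ℝ))) atTop
        (𝓝 (f (-s))) := by
    intro m hm
    refine hcont.tendsto.comp (tendsto_pi_nhds.2 fun j => ?_)
    have h2 : Tendsto (fun M : ℕ => (1 / ((M + 1 : ℕ) : ℝ))) atTop (𝓝 0) := by
      simpa only [one_div] using! tendsto_inv_atTop_zero.comp tendsto_natCast_succ_atTop
    have h3 := h2.neg.sub (hm j)
    rw [neg_zero, zero_sub] at h3
    refine h3.congr fun M => ?_
    simp only [Pi.sub_apply, b]
    ring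
  have hmom : ∀ (m : ℕ → Fin n → ℕ) (M : ℕ), (∀ j, s j * ((M + 1 : ℕ) : ℝ) + 1 ≤
      (((M + 1) ^ 3 : ℕ) : ℝ)) → (∀ j, (m M j : ℝ) ≤ s j * ((M + 1 : ℕ) : ℝ) + 1) →
      |f (b M - fun j => 1 / ((M + 1 : ℕ) : ℝ) * (m M j : ℝ)) -
        ∑ k ∈ Fintype.piFinset fun _ : Fin n => Finset.range ((M + 1) ^ 3 + 1),
          w M k * ∏ j, ((k j : ℝ) / ((M + 1) ^ 3 : ℕ)) ^ m M j| ≤ err M := by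
    intro m M h1 h2
    refine (hw M (m M) fun j => by exact_mod_cast (h2 j).trans (h1 j)).trans ?_
    refine mul_le_mul (hC _ (hb M)) (Finset.sum_le_sum fun j _ => ?_)
      (Finset.sum_nonneg fun j _ => by positivity) hC0
    have := h2 j
    gcongr
  have hval : ∀ M, ∫ y, cubePow s y ∂(ρ M : Measure (Fin n → unitInterval)) =
      ∑ k ∈ Fintype.piFinset fun _ : Fin n => Finset.range ((M + 1) ^ 3 + 1),
        w M k * ∏ j, ((k j : ℝ) / ((M + 1) ^ 3 : ℕ)) ^ (s j * ((M + 1 : ℕ) : ℝ)) := by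
    intro M
    rw [hρ M _ (continuous_cubePow hs).stronglyMeasurable]
    refine Finset.sum_congr rfl fun k hk => ?_
    congr 1
    refine Finset.prod_congr rfl fun j _ => ?_
    have hk : k j ≤ (M + 1) ^ 3 :=
      Nat.lt_succ_iff.1 (Finset.mem_range.1 (Fintype.mem_piFinset.1 hk j))
    have hx : (k j : ℝ) / ((M + 1) ^ 3 : ℕ) ∈ Set.Icc (0 : ℝ) 1 :=
      ⟨by positivity, div_le_one_of_le₀ (by exact_mod_cast hk) (by positivity)⟩
    rw [show ((pt M k j : unitInterval) : ℝ) = ((k j : ℝ) / ((M + 1) ^ 3 : ℕ)) ^ (M + 1) from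
      congrArg Subtype.val (Set.projIcc_of_mem zero_le_one
        ⟨pow_nonneg hx.1 _, pow_le_one₀ hx.1 hx.2⟩), ← Real.rpow_natCast, ← Real.rpow_mul hx.1,
      mul_comm]
  have hfloor : ∀ j, Tendsto (fun M : ℕ => (⌊s j * ((M + 1 : ℕ) : ℝ)⌋₊ : ℝ) /
      ((M + 1 : ℕ) : ℝ)) atTop (𝓝 (s j)) := fun j =>
    (tendsto_nat_floor_mul_div_atTop (hs j).le).comp tendsto_natCast_succ_atTop
  have hceil : ∀ j, Tendsto (fun M : ℕ => (⌈s j * ((M + 1 : ℕ) : ℝ)⌉₊ : ℝ) /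
      ((M + 1 : ℕ) : ℝ)) atTop (𝓝 (s j)) := fun j =>
    (tendsto_nat_ceil_mul_div_atTop (hs j).le).comp tendsto_natCast_succ_atTop
  have hsM : ∀ (M : ℕ) j, 0 ≤ s j * ((M + 1 : ℕ) : ℝ) := fun M j =>
    mul_nonneg (hs j).le (Nat.cast_nonneg _)
  have hpow : ∀ M, ∀ k ∈ Fintype.piFinset fun _ : Fin n => Finset.range ((M + 1) ^ 3 + 1),
      ∀ p q : Fin n → ℝ, (∀ j, 0 ≤ p j) → (∀ j, p j ≤ q j) →
      w M k * ∏ j, ((k j : ℝ) / ((M + 1) ^ 3 : ℕ)) ^ q j ≤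
        w M k * ∏ j, ((k j : ℝ) / ((M + 1) ^ 3 : ℕ)) ^ p j := by
    intro M k hk p q hp hpq
    refine mul_le_mul_of_nonneg_left (Finset.prod_le_prod (fun j _ => by positivity)
      fun j _ => ?_) (hw0 M k)
    have hk : k j ≤ (M + 1) ^ 3 :=
      Nat.lt_succ_iff.1 (Finset.mem_range.1 (Fintype.mem_piFinset.1 hk j))
    exact Real.rpow_le_rpow_of_exponent_ge' (by positivity)
      (div_le_one_of_le₀ (by exact_mod_cast hk) (by positivity)) (hp j) (hpq j)
  -- `x^{sN}` lies between the powers with exponents `⌈sN⌉` and `⌊sN⌋`, as `0 ≤ x ≤ 1`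
  have hlim₂ : Tendsto (fun M => ∫ y, cubePow s y ∂(ρ M : Measure (Fin n → unitInterval)))
      atTop (𝓝 (f (-s))) := by
    have hlow := (hgrid (fun M j => ⌈s j * ((M + 1 : ℕ) : ℝ)⌉₊) hceil).sub herr
    have hupp := (hgrid (fun M j => ⌊s j * ((M + 1 : ℕ) : ℝ)⌋₊) hfloor).add herr
    rw [sub_zero] at hlow
    rw [add_zero] at hupp
    refine tendsto_of_tendsto_of_tendsto_of_le_of_le' hlow hupp ?_ ?_
    · filter_upwards [hbd] with M hM
      have h1 := hmom (fun M j => ⌈s j * ((M + 1 : ℕ) : ℝ)⌉₊) M hM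
        fun j => (Nat.ceil_lt_add_one (hsM M j)).le
      have h2 := Finset.sum_le_sum fun k hk => hpow M k hk (fun j => s j * ((M + 1 : ℕ) : ℝ))
        (fun j => (⌈s j * ((M + 1 : ℕ) : ℝ)⌉₊ : ℝ)) (hsM M) fun j => Nat.le_ceil _
      simp only [Real.rpow_natCast] at h2
      rw [← hval] at h2
      linarith [(abs_le.1 h1).2]
    · filter_upwards [hbd] with M hM
      have h1 := hmom (fun M j => ⌊s j * ((M + 1 : ℕ) : ℝ)⌋₊) M hM
        fun j => (Nat.floor_le (hsM M j)).trans (le_add_of_nonneg_right zero_le_one)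
      have h2 := Finset.sum_le_sum fun k hk => hpow M k hk
        (fun j => (⌊s j * ((M + 1 : ℕ) : ℝ)⌋₊ : ℝ)) (fun j => s j * ((M + 1 : ℕ) : ℝ))
        (fun j => Nat.cast_nonneg _) fun j => Nat.floor_le (hsM M j)
      simp only [Real.rpow_natCast] at h2
      rw [← hval] at h2
      linarith [(abs_le.1 h1).1]
  exact tendsto_nhds_unique hlim₁ (hlim₂.mono_left Nat.hyperfilter_le_atTop)

/-- **Bernstein's theorem**: bounded continuous absolutely monotone functions on `(-∞; 0)ⁿ`
are the Laplace transforms of the bounded positive measures on `ℝ₊ⁿ`. -/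
theorem exists_finiteMeasure_laplace (hf : DiffMonotone f) (hc : ContinuousOn f (negOrthant n))
    {C : ℝ} (hC : ∀ s ∈ negOrthant n, f s ≤ C) :
    ∃ ρ : FiniteMeasure (Fin n → ℝ≥0), ∀ s ∈ negOrthant n,
      ∫ u : Fin n → ℝ≥0, Real.exp (∑ j, s j * (u j : ℝ)) ∂(ρ : Measure (Fin n → ℝ≥0)) = f s := by
  obtain ⟨ρ, hρ⟩ := exists_finiteMeasure_cube hf hc hC
  let P : Set (Fin n → unitInterval) := {y | ∀ j, 0 < (y j : ℝ)}
  have hP : MeasurableSet P := by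
    have : P = ⋂ j, {y : Fin n → unitInterval | 0 < (y j : ℝ)} := by ext; simp [P]
    rw [this]
    exact MeasurableSet.iInter fun j => measurableSet_lt measurable_const
      (measurable_subtype_coe.comp (measurable_pi_apply j))
  -- the substitution `y = e^{-u}`
  let φ : (Fin n → unitInterval) → Fin n → ℝ≥0 := fun y j => (-Real.log (y j : ℝ)).toNNReal
  have hφ : Measurable φ := measurable_pi_lambda _ fun j =>
    (Real.measurable_log.comp
      (measurable_subtype_coe.comp (measurable_pi_apply j))).neg.real_toNNReal
  refine ⟨⟨(((ρ : Measure (Fin n → unitInterval)).restrict P).map φ), inferInstance⟩,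
    fun s hs => ?_⟩
  have hcont : Continuous fun u : Fin n → ℝ≥0 => Real.exp (∑ j, s j * (u j : ℝ)) := by fun_prop
  have h1 := hρ (-s) fun j => neg_pos.2 (hs j)
  rw [neg_neg] at h1
  rw [← h1, FiniteMeasure.toMeasure_mk, integral_map hφ.aemeasurable hcont.aestronglyMeasurable,
    ← setIntegral_eq_integral_of_forall_compl_eq_zero (s := P) (f := cubePow (-s))]
  · refine setIntegral_congr_fun hP fun y hy => ?_
    simp only [cubePow, Real.exp_sum]
    refine Finset.prod_congr rfl fun j _ => ?_
    rw [Real.coe_toNNReal _ (neg_nonneg.2 (Real.log_nonpos (y j).2.1 (y j).2.2)),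
      Real.rpow_def_of_pos (hy j), Pi.neg_apply]
    congr 1
    ring
  · intro y hy
    obtain ⟨j, hj⟩ := not_forall.1 hy
    have hj : (y j : ℝ) = 0 := le_antisymm (not_lt.1 hj) (y j).2.1
    refine Finset.prod_eq_zero (Finset.mem_univ j) ?_
    rw [hj, Pi.neg_apply, Real.zero_rpow (neg_ne_zero.2 (hs j).ne)]

end BochnerPhillips

namespace BochnerPhillips

/-! ### The exponentials `e^{s·u}` and uniqueness of the Laplace transform -/

variable {n : ℕ}

/-- The exponential `u ↦ e^{s·u}` on `ℝ₊ⁿ`. -/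
noncomputable def expKernel (s : Fin n → ℝ) (u : Fin n → ℝ≥0) : ℝ :=
  Real.exp (∑ j, s j * (u j : ℝ))

@[fun_prop]
theorem continuous_expKernel (s : Fin n → ℝ) : Continuous (expKernel s) := by
  unfold expKernel
  fun_prop

theorem expKernel_pos (s : Fin n → ℝ) (u : Fin n → ℝ≥0) : 0 < expKernel s u := Real.exp_pos _

theorem expKernel_le_one {s : Fin n → ℝ} (hs : s ≤ 0) (u : Fin n → ℝ≥0) : expKernel s u ≤ 1 :=
  Real.exp_le_one_iff.2 (Finset.sum_nonpos fun j _ =>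
    mul_nonpos_of_nonpos_of_nonneg (hs j) (u j).2)

theorem expKernel_add (s t : Fin n → ℝ) (u : Fin n → ℝ≥0) :
    expKernel (s + t) u = expKernel s u * expKernel t u := by
  simp only [expKernel, ← Real.exp_add, ← Finset.sum_add_distrib, Pi.add_apply, add_mul]

theorem expKernel_zero_left (u : Fin n → ℝ≥0) : expKernel 0 u = 1 := by simp [expKernel]

theorem expKernel_zero_right (s : Fin n → ℝ) : expKernel s 0 = 1 := by simp [expKernel]

theorem le_zero_of_mem_negOrthant {s : Fin n → ℝ} (hs : s ∈ negOrthant n) : s ≤ 0 :=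
  fun j => (hs j).le

theorem neg_one_mem_negOrthant : (-1 : Fin n → ℝ) ∈ negOrthant n := fun _ => neg_one_lt_zero

theorem integrable_expKernel {s : Fin n → ℝ} (hs : s ≤ 0) (ρ : Measure (Fin n → ℝ≥0))
    [IsFiniteMeasure ρ] : Integrable (expKernel s) ρ :=
  Integrable.of_bound (continuous_expKernel s).aestronglyMeasurable 1 (Eventually.of_forall
    fun u => by rw [Real.norm_of_nonneg (expKernel_pos s u).le]; exact expKernel_le_one hs u)

/-- The weight `1 - e^{-|u|}`, where `|u| = u₁ + ⋯ + uₙ`. It is comparable to `min(1, |u|)`. -/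
noncomputable def levyWeight (u : Fin n → ℝ≥0) : ℝ := 1 - expKernel (-1) u

@[fun_prop]
theorem continuous_levyWeight : Continuous (levyWeight (n := n)) := by
  unfold levyWeight
  fun_prop

theorem levyWeight_nonneg (u : Fin n → ℝ≥0) : 0 ≤ levyWeight u :=
  sub_nonneg.2 (expKernel_le_one (le_zero_of_mem_negOrthant neg_one_mem_negOrthant) u)

theorem levyWeight_pos {u : Fin n → ℝ≥0} (hu : u ≠ 0) : 0 < levyWeight u := by
  obtain ⟨j, hj⟩ := Function.ne_iff.1 hu
  have : 0 < ∑ j, (u j : ℝ) := Finset.sum_pos' (fun j _ => (u j).2)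
    ⟨j, Finset.mem_univ j, NNReal.coe_pos.2 (pos_iff_ne_zero.2 hj)⟩
  refine sub_pos.2 (Real.exp_lt_one_iff.2 ?_)
  simpa using this

/-- Comparison with the weight: a quantity bounded by a constant and by a multiple of `|u|` is
bounded by a multiple of `1 - e^{-|u|}`. -/
theorem le_levyWeight {A B x : ℝ} (hA : 0 ≤ A) (hB : 0 ≤ B) {u : Fin n → ℝ≥0} (h1 : x ≤ A)
    (h2 : x ≤ B * ∑ j, (u j : ℝ)) : x ≤ (A + B) * levyWeight u := by
  set r := ∑ j, (u j : ℝ) with hr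
  have hr0 : 0 ≤ r := Finset.sum_nonneg fun j _ => (u j).2
  have h3 : r / (1 + r) ≤ levyWeight u := by
    have h4 : levyWeight u = 1 - (Real.exp r)⁻¹ := by
      simp [levyWeight, expKernel, hr, ← Real.exp_neg, Finset.sum_neg_distrib]
    have h5 : (Real.exp r)⁻¹ ≤ (1 + r)⁻¹ :=
      inv_anti₀ (by positivity) (by linarith [Real.add_one_le_exp r])
    have h6 : r / (1 + r) = 1 - (1 + r)⁻¹ := by field_simp; ring
    rw [h4, h6]
    linarith
  refine le_trans ?_ (mul_le_mul_of_nonneg_left h3 (add_nonneg hA hB))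
  rw [← mul_div_assoc, le_div_iff₀ (by positivity)]
  nlinarith [mul_le_mul_of_nonneg_right h1 hr0]

/-- The span of the exponentials `e^{s·u}` with `s ≤ 0`, an algebra of bounded continuous
functions. -/
noncomputable def expSubalgebra (n : ℕ) :
    StarSubalgebra ℝ (BoundedContinuousFunction (Fin n → ℝ≥0) ℝ) where
  toSubalgebra := Algebra.adjoin ℝ {g | ∃ s : Fin n → ℝ, s ≤ 0 ∧ ∀ u, g u = expKernel s u}
  star_mem' {g} hg := by
    rwa [show star g = g from BoundedContinuousFunction.ext fun u => star_trivial (g u)]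

/-- A bounded measure on `ℝ₊ⁿ` is determined by its Laplace transform on `(-∞; 0)ⁿ`. -/
theorem ext_of_integral_expKernel {ρ ν : Measure (Fin n → ℝ≥0)} [IsFiniteMeasure ρ]
    [IsFiniteMeasure ν]
    (h : ∀ s ∈ negOrthant n, ∫ u, expKernel s u ∂ρ = ∫ u, expKernel s u ∂ν) : ρ = ν := by
  -- the equality extends to the closed orthant
  have hcl : ∀ s : Fin n → ℝ, s ≤ 0 → ∫ u, expKernel s u ∂ρ = ∫ u, expKernel s u ∂ν := by
    intro s hs
    let t : ℕ → Fin n → ℝ := fun m j => s j - ((m : ℝ) + 1)⁻¹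
    have ht : ∀ m, t m ∈ negOrthant n := fun m j => by
      have h1 := hs j
      have h2 : (0 : ℝ) < ((m : ℝ) + 1)⁻¹ := by positivity
      simp only [Pi.zero_apply, t] at *
      linarith
    have hlim : ∀ (ρ : Measure (Fin n → ℝ≥0)) [IsFiniteMeasure ρ],
        Tendsto (fun m => ∫ u, expKernel (t m) u ∂ρ) atTop (𝓝 (∫ u, expKernel s u ∂ρ)) := by
      intro ρ _
      refine tendsto_integral_of_dominated_convergence (fun _ => 1)
        (fun m => (continuous_expKernel _).aestronglyMeasurable) (integrable_const 1)
        (fun m => Eventually.of_forall fun u => ?_) (Eventually.of_forall fun u => ?_)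
      · rw [Real.norm_of_nonneg (expKernel_pos _ u).le]
        exact expKernel_le_one (le_zero_of_mem_negOrthant (ht m)) u
      · refine (Real.continuous_exp.tendsto _).comp (tendsto_finsetSum _ fun j _ => ?_)
        refine Tendsto.mul_const _ ?_
        have : Tendsto (fun m : ℕ => ((m : ℝ) + 1)⁻¹) atTop (𝓝 0) := by
          simpa using tendsto_one_div_add_atTop_nhds_zero_nat (𝕜 := ℝ)
        simpa using this.const_sub (s j)
    exact tendsto_nhds_unique (hlim ρ) ((hlim ν).congr fun m => (h _ (ht m)).symm)
  let e : ∀ s : Fin n → ℝ, s ≤ 0 → BoundedContinuousFunction (Fin n → ℝ≥0) ℝ := fun s hs =>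
    BoundedContinuousFunction.ofNormedAddCommGroup (expKernel s) (continuous_expKernel s) 1
      fun u => by rw [Real.norm_of_nonneg (expKernel_pos s u).le]; exact expKernel_le_one hs u
  let S : Submonoid (BoundedContinuousFunction (Fin n → ℝ≥0) ℝ) :=
    { carrier := {g | ∃ s : Fin n → ℝ, s ≤ 0 ∧ ∀ u, g u = expKernel s u}
      one_mem' := ⟨0, le_rfl, fun u => (expKernel_zero_left u).symm⟩
      mul_mem' := by
        rintro a b ⟨s, hs, ha⟩ ⟨t, ht, hb⟩
        exact ⟨s + t, add_nonpos hs ht, fun u => by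
          rw [BoundedContinuousFunction.mul_apply, ha, hb, expKernel_add]⟩ }
  refine ext_of_forall_mem_subalgebra_integral_eq_of_polish (𝕜 := ℝ) (A := expSubalgebra n) ?_ ?_
  · intro u v huv
    obtain ⟨j, hj⟩ := Function.ne_iff.1 huv
    have hs : (-Pi.single j 1 : Fin n → ℝ) ≤ 0 :=
      neg_nonpos.2 (Pi.single_nonneg.2 zero_le_one)
    have hval : ∀ w : Fin n → ℝ≥0, expKernel (-Pi.single j 1) w = Real.exp (-(w j : ℝ)) :=
      fun w => by simp [expKernel, Pi.single_apply]
    refine ⟨_, ⟨_, ⟨e _ hs, Algebra.subset_adjoin ⟨_, hs, fun _ => rfl⟩, rfl⟩, rfl⟩, ?_⟩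
    change expKernel _ u ≠ expKernel _ v
    rw [hval, hval]
    simpa using hj
  · intro g hg
    have hspan : g ∈ Submodule.span ℝ (S : Set (BoundedContinuousFunction (Fin n → ℝ≥0) ℝ)) := by
      have h1 : g ∈ Subalgebra.toSubmodule (Algebra.adjoin ℝ
        (S : Set (BoundedContinuousFunction (Fin n → ℝ≥0) ℝ))) := hg
      rwa [Algebra.adjoin_eq_span, Submonoid.closure_eq] at h1
    clear hg
    induction hspan using Submodule.span_induction with
    | mem g hg =>
      obtain ⟨s, hs, hg⟩ := hg
      simp only [hg]
      exact hcl s hs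
    | zero => simp
    | add a b _ _ ha hb =>
      simp only [BoundedContinuousFunction.coe_add, Pi.add_apply]
      rw [integral_add (a.integrable _) (b.integrable _),
        integral_add (a.integrable _) (b.integrable _), ha, hb]
    | smul c a _ ha =>
      simp only [BoundedContinuousFunction.coe_smul]
      rw [integral_smul, integral_smul, ha]

/-! ### The measures `ν_t` -/

theorem IsBernstein.exists_subordinator {ψ : (Fin n → ℝ) → ℝ} (hψ : IsBernstein ψ) (t : ℝ≥0) :
    ∃ ν : FiniteMeasure (Fin n → ℝ≥0), ∀ s ∈ negOrthant n,
      ∫ u : Fin n → ℝ≥0, Real.exp (∑ j, s j * (u j : ℝ)) ∂(ν : Measure (Fin n → ℝ≥0)) =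
        Real.exp ((t : ℝ) * ψ s) := by
  refine exists_finiteMeasure_laplace (C := 1) (diffMonotone_exp fun h hh k => ?_) ?_ fun s hs => ?_
  · refine ((diffNonneg_const t.2).mul (hψ.diffMonotone_backDiff hh k)).congr fun s _ => ?_
    simp only [backDiff, mul_sub]
    rfl
  · exact (continuousOn_const.mul hψ.1.continuousOn).rexp
  · exact Real.exp_le_one_iff.2 (mul_nonpos_of_nonneg_of_nonpos t.2 (hψ.2.1 s hs))

theorem IsBernstein.integral_subordinator {ψ : (Fin n → ℝ) → ℝ} (hψ : IsBernstein ψ) (t : ℝ≥0)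
    {s : Fin n → ℝ} (hs : s ∈ negOrthant n) :
    ∫ u, expKernel s u ∂(subordinator ψ t : Measure (Fin n → ℝ≥0)) =
      Real.exp ((t : ℝ) * ψ s) :=
  Classical.epsilon_spec (hψ.exists_subordinator t) s hs

/-! ### The integral representation of Bernstein functions -/

/-- Cauchy's functional equation: nonnegative additive functions on `ℝ₊` are linear. -/
theorem eq_mul_of_additive_of_nonneg {g : ℝ → ℝ} (h0 : ∀ r, 0 ≤ r → 0 ≤ g r)
    (hadd : ∀ r r', 0 ≤ r → 0 ≤ r' → g (r + r') = g r + g r') {r : ℝ} (hr : 0 ≤ r) :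
    g r = r * g 1 := by
  have hmono : ∀ a b, 0 ≤ a → a ≤ b → g a ≤ g b := fun a b ha hab => by
    have := hadd a (b - a) ha (sub_nonneg.2 hab)
    rw [add_sub_cancel] at this
    linarith [h0 (b - a) (sub_nonneg.2 hab)]
  have hnat : ∀ (N : ℕ) a, 0 ≤ a → g (N * a) = N * g a := fun N a ha => by
    induction N with
    | zero =>
      have := hadd 0 0 le_rfl le_rfl
      simp only [add_zero] at this
      simp only [Nat.cast_zero, zero_mul]
      linarith
    | succ N ih =>
      push_cast
      rw [add_mul, one_mul, hadd _ _ (by positivity) ha, ih]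
      ring
  have hbd : ∀ N : ℕ, N * |g r - r * g 1| ≤ g 1 := fun N => by
    have hNr : 0 ≤ N * r := by positivity
    have h1 := hmono _ _ (Nat.cast_nonneg _) (Nat.floor_le hNr)
    have h2 := hmono _ _ hNr (Nat.lt_floor_add_one (N * r : ℝ)).le
    have h3 := hnat ⌊N * r⌋₊ 1 zero_le_one
    have h4 := hnat (⌊N * r⌋₊ + 1) 1 zero_le_one
    push_cast at h4
    rw [mul_one] at h3 h4
    rw [h3, hnat _ _ hr] at h1
    rw [h4, hnat _ _ hr] at h2
    have h5 := mul_le_mul_of_nonneg_right (Nat.floor_le hNr) (h0 1 zero_le_one)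
    have h6 := mul_le_mul_of_nonneg_right (Nat.lt_floor_add_one (N * r : ℝ)).le (h0 1 zero_le_one)
    rw [← abs_of_nonneg (Nat.cast_nonneg (α := ℝ) N), ← abs_mul, abs_le]
    constructor <;> nlinarith
  by_contra hne
  have hpos : 0 < |g r - r * g 1| := abs_pos.2 (sub_ne_zero.2 hne)
  obtain ⟨N, hN⟩ := exists_nat_gt (g 1 / |g r - r * g 1|)
  rw [div_lt_iff₀ hpos] at hN
  exact absurd (hbd N) (not_le.2 hN)

/-- A function whose backward differences are nonnegative constants is affine. -/
theorem exists_affine_of_backDiff_eq {F c : (Fin n → ℝ) → ℝ} (hc : ∀ h, 0 ≤ h → 0 ≤ c h)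
    (hF : ∀ s ∈ negOrthant n, ∀ h, 0 ≤ h → backDiff h F s = c h) :
    ∃ (c₀ : ℝ) (c₁ : Fin n → ℝ≥0), ∀ s ∈ negOrthant n, F s = c₀ + ∑ j, (c₁ j : ℝ) * s j := by
  have hadd : ∀ h h' : Fin n → ℝ, 0 ≤ h → 0 ≤ h' → c (h + h') = c h + c h' := by
    intro h h' hh hh'
    have hm := neg_one_mem_negOrthant (n := n)
    rw [← hF _ hm _ (add_nonneg hh hh'), ← hF _ hm _ hh,
      ← hF _ (sub_mem_negOrthant hm hh) _ hh']
    simp only [backDiff, sub_sub]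
    ring
  have hsingle : ∀ (j : Fin n) r, 0 ≤ r → c (Pi.single j r) = r * c (Pi.single j 1) :=
    fun j r hr => eq_mul_of_additive_of_nonneg (g := fun r => c (Pi.single j r))
      (fun r hr => hc _ (Pi.single_nonneg.2 hr))
      (fun r r' hr hr' => by
        simp only [Pi.single_add]
        exact hadd _ _ (Pi.single_nonneg.2 hr) (Pi.single_nonneg.2 hr')) hr
  have hsum : ∀ h : Fin n → ℝ, 0 ≤ h → c h = ∑ j, h j * c (Pi.single j 1) := by
    intro h hh
    have h0 : c 0 = 0 := by simpa using hadd 0 0 le_rfl le_rfl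
    have : ∀ t : Finset (Fin n), c (∑ j ∈ t, Pi.single j (h j)) =
        ∑ j ∈ t, h j * c (Pi.single j 1) := by
      intro t
      induction t using Finset.induction_on with
      | empty => simpa using h0
      | insert i t hi ih =>
        rw [Finset.sum_insert hi, Finset.sum_insert hi, hadd _ _ (Pi.single_nonneg.2 (hh i))
          (Finset.sum_nonneg fun j _ => Pi.single_nonneg.2 (hh j)), ih, hsingle _ _ (hh i)]
    have h1 := this Finset.univ
    rwa [Finset.univ_sum_single] at h1
  refine ⟨F (-1) + ∑ j, c (Pi.single j 1), fun j =>
    (c (Pi.single j 1)).toNNReal, fun s hs => ?_⟩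
  have h1 := hF s hs (s - s ⊓ -1) (sub_nonneg.2 inf_le_left)
  have h2 := hF (-1) neg_one_mem_negOrthant (-1 - s ⊓ -1) (sub_nonneg.2 inf_le_right)
  rw [hsum _ (sub_nonneg.2 inf_le_left)] at h1
  rw [hsum _ (sub_nonneg.2 inf_le_right)] at h2
  simp only [backDiff, sub_sub_cancel, Pi.sub_apply, Pi.neg_apply, Pi.one_apply] at h1 h2
  have h3 : F s = F (-1) + (∑ j, (s j - (s ⊓ -1) j) * c (Pi.single j 1) -
      ∑ j, (-1 - (s ⊓ -1) j) * c (Pi.single j 1)) := by linarith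
  rw [h3, ← Finset.sum_sub_distrib, add_assoc, ← Finset.sum_add_distrib]
  congr 1
  refine Finset.sum_congr rfl fun j _ => ?_
  rw [Real.coe_toNNReal _ (hc _ (Pi.single_nonneg.2 zero_le_one))]
  ring

/-- A measure that integrates the weight `1 - e^{-|u|}` integrates all functions `1 - e^{s·u}`. -/
theorem integrable_expKernel_sub_one {μ : Measure (Fin n → ℝ≥0)} (hμ : Integrable levyWeight μ)
    {s : Fin n → ℝ} (hs : s ≤ 0) : Integrable (fun u => expKernel s u - 1) μ := by
  have hB : 0 ≤ ∑ j, |s j| := Finset.sum_nonneg fun j _ => abs_nonneg _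
  refine (hμ.const_mul (1 + ∑ j, |s j|)).mono'
    ((continuous_expKernel s).sub continuous_const).aestronglyMeasurable
    (Eventually.of_forall fun u => ?_)
  have h1 := expKernel_le_one hs u
  have h2 := expKernel_pos s u
  rw [Real.norm_eq_abs, abs_of_nonpos (by linarith)]
  refine le_levyWeight zero_le_one hB (by linarith) ?_
  have h3 := Real.add_one_le_exp (∑ j, s j * (u j : ℝ))
  have h4 : -∑ j, s j * (u j : ℝ) ≤ (∑ j, |s j|) * ∑ j, (u j : ℝ) := by
    rw [← Finset.sum_neg_distrib, Finset.sum_mul]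
    refine Finset.sum_le_sum fun j _ => ?_
    rw [← neg_mul]
    exact mul_le_mul (neg_le_abs _) (Finset.single_le_sum (f := fun j => (u j : ℝ))
      (fun i _ => (u i).2) (Finset.mem_univ j)) (u j).2 (abs_nonneg _)
  unfold expKernel
  linarith

/-- Existence of the integral representation. With `ρ_h` the measure whose Laplace transform is
`Δ_h ψ`, the measures `(1 - e^{-h·u})⁻¹ ρ_h` on `ℝ₊ⁿ \ {0}` do not depend on `h`, and give `μ`. The
atoms `ρ_h({0})` are the differences of what remains of `ψ`, which is therefore affine. -/
theorem IsBernstein.exists_represents {ψ : (Fin n → ℝ) → ℝ} (hψ : IsBernstein ψ) :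
    ∃ d : LevyData n, d.Represents ψ := by
  -- the differences of `ψ` are Laplace transforms
  have hρ : ∀ h : Fin n → ℝ, ∃ ρ : FiniteMeasure (Fin n → ℝ≥0), 0 ≤ h → ∀ s ∈ negOrthant n,
      ∫ u, expKernel s u ∂(ρ : Measure (Fin n → ℝ≥0)) = backDiff h ψ s := by
    intro h
    by_cases hh : 0 ≤ h
    · have hψc := hψ.1.continuousOn
      -- a bound of `Δ_h ψ`: increase the argument to at least `-1`, and use `ψ ≤ 0` there
      have hbd : ∀ s ∈ negOrthant n, backDiff h ψ s ≤ -ψ (-1 - h) := fun s hs => by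
        have hm := neg_one_mem_negOrthant (n := n)
        have hs' : s ⊔ -1 ∈ negOrthant n := fun j => max_lt (hs j) (hm j)
        have h1 := (hψ.diffMonotone_backDiff hh).monotoneOn hs hs' le_sup_left
        have h2 := ((hψ.diffMonotone_backDiff (h := s ⊔ -1 - -1)
          (sub_nonneg.2 le_sup_right)) 0).nonneg (sub_mem_negOrthant hs' hh)
        have h3 : s ⊔ -1 - h - (s ⊔ -1 - -1) = -1 - h := by abel
        have h4 := hψ.2.1 _ hs'
        simp only [backDiff, h3] at h1 h2 ⊢
        linarith
      obtain ⟨ρ, hρ⟩ := exists_finiteMeasure_laplace (hψ.diffMonotone_backDiff hh)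
        (hψc.sub (hψc.comp (continuousOn_id.sub continuousOn_const)
          fun s hs => sub_mem_negOrthant hs hh)) hbd
      exact ⟨ρ, fun _ => hρ⟩
    · exact ⟨0, fun h0 => absurd h0 hh⟩
  choose ρ hρ using hρ
  have h1nn : (0 : Fin n → ℝ) ≤ 1 := zero_le_one
  have hE : ∀ {s : Fin n → ℝ} u, s ≤ 0 → 0 ≤ 1 - expKernel s u := fun u hs =>
    sub_nonneg.2 (expKernel_le_one hs u)
  have hneg : ∀ {h : Fin n → ℝ}, 0 ≤ h → -h ≤ 0 := fun hh => neg_nonpos.2 hh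
  have hdens : ∀ (h : Fin n → ℝ), 0 ≤ h → ∀ (ρ : Measure (Fin n → ℝ≥0)) (A : Set (Fin n → ℝ≥0)),
      MeasurableSet A → ∀ F : (Fin n → ℝ≥0) → ℝ,
      ∫ u in A, F u ∂(ρ.withDensity fun u => ENNReal.ofReal (1 - expKernel (-h) u)) =
        ∫ u in A, (1 - expKernel (-h) u) * F u ∂ρ := by
    intro h hh ρ A hA F
    rw [restrict_withDensity hA, integral_withDensity_eq_integral_toReal_smul
      (by fun_prop) (Eventually.of_forall fun _ => ENNReal.ofReal_lt_top)]
    refine integral_congr_ae (Eventually.of_forall fun u => ?_)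
    simp only [ENNReal.toReal_ofReal (hE u (hneg hh)), smul_eq_mul]
  have hdens_fin : ∀ (h : Fin n → ℝ), 0 ≤ h → ∀ (ρ : Measure (Fin n → ℝ≥0)) [IsFiniteMeasure ρ],
      IsFiniteMeasure (ρ.withDensity fun u => ENNReal.ofReal (1 - expKernel (-h) u)) := by
    intro h hh ρ _
    exact isFiniteMeasure_withDensity_ofReal
      ((integrable_const 1).sub (integrable_expKernel (hneg hh) ρ)).hasFiniteIntegral
  -- consistency of the measures `ρ h`, by uniqueness of the Laplace transform
  have hcons : ∀ h, 0 ≤ h →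
      (ρ 1 : Measure (Fin n → ℝ≥0)).withDensity (fun u => ENNReal.ofReal (1 - expKernel (-h) u)) =
      (ρ h : Measure (Fin n → ℝ≥0)).withDensity
        (fun u => ENNReal.ofReal (1 - expKernel (-1) u)) := by
    intro h hh
    have := hdens_fin h hh (ρ 1)
    have := hdens_fin 1 h1nn (ρ h)
    refine ext_of_integral_expKernel fun s hs => ?_
    have key : ∀ h h' : Fin n → ℝ, 0 ≤ h → 0 ≤ h' →
        ∫ u, expKernel s u ∂((ρ h : Measure (Fin n → ℝ≥0)).withDensity
          (fun u => ENNReal.ofReal (1 - expKernel (-h') u))) =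
        backDiff h ψ s - backDiff h ψ (s - h') := by
      intro h h' hh hh'
      rw [← hρ h hh s hs, ← hρ h hh _ (sub_mem_negOrthant hs hh'), ← integral_sub
        (integrable_expKernel (le_zero_of_mem_negOrthant hs) _) (integrable_expKernel
        (le_zero_of_mem_negOrthant (sub_mem_negOrthant hs hh')) _), ← setIntegral_univ,
        hdens h' hh' _ _ MeasurableSet.univ, setIntegral_univ]
      refine integral_congr_ae (Eventually.of_forall fun u => ?_)
      simp only [sub_eq_add_neg s, expKernel_add]
      ring
    rw [key 1 h h1nn hh, key h 1 hh h1nn]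
    simp only [backDiff, sub_right_comm _ h]
    ring
  -- `levyWeight u` is `1 - e^{-h·u}` for `h = (1, …, 1)`
  let Z : Set (Fin n → ℝ≥0) := {0}ᶜ
  have hZ : MeasurableSet Z := (measurableSet_singleton 0).compl
  let μ : Measure (Fin n → ℝ≥0) := ((ρ 1 : Measure (Fin n → ℝ≥0)).restrict Z).withDensity
    fun u => ENNReal.ofReal (levyWeight u)⁻¹
  have hmeas : Measurable fun u : Fin n → ℝ≥0 => ENNReal.ofReal (levyWeight u)⁻¹ :=
    continuous_levyWeight.measurable.inv.ennreal_ofReal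
  have hμint : ∀ F : (Fin n → ℝ≥0) → ℝ, ∫ u, F u ∂μ =
      ∫ u in Z, (levyWeight u)⁻¹ * F u ∂(ρ 1 : Measure (Fin n → ℝ≥0)) := by
    intro F
    rw [integral_withDensity_eq_integral_toReal_smul hmeas
      (Eventually.of_forall fun _ => ENNReal.ofReal_lt_top)]
    refine integral_congr_ae (Eventually.of_forall fun u => ?_)
    simp only [ENNReal.toReal_ofReal (inv_nonneg.2 (levyWeight_nonneg u)), smul_eq_mul]
  have hμW : Integrable levyWeight μ := by
    rw [integrable_withDensity_iff_integrable_smul' hmeas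
      (Eventually.of_forall fun _ => ENNReal.ofReal_lt_top)]
    refine (integrable_const (1 : ℝ)).congr ?_
    filter_upwards [ae_restrict_mem hZ] with u hu
    rw [ENNReal.toReal_ofReal (inv_nonneg.2 (levyWeight_nonneg u)), smul_eq_mul,
      inv_mul_cancel₀ (levyWeight_pos hu).ne']
  have hcomp : ∀ s ∈ negOrthant n, ∀ h, 0 ≤ h →
      backDiff h (fun s => ψ s - ∫ u, (expKernel s u - 1) ∂μ) s =
        (ρ h : Measure (Fin n → ℝ≥0)).real {0} := by
    intro s hs h hh
    have hs' := sub_mem_negOrthant hs hh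
    have h1 : ∫ u, (expKernel s u - 1) ∂μ - ∫ u, (expKernel (s - h) u - 1) ∂μ =
        ∫ u in Z, expKernel s u ∂(ρ h : Measure (Fin n → ℝ≥0)) := by
      rw [← integral_sub (integrable_expKernel_sub_one hμW (le_zero_of_mem_negOrthant hs))
        (integrable_expKernel_sub_one hμW (le_zero_of_mem_negOrthant hs')), hμint]
      have h2 : ∀ u, (levyWeight u)⁻¹ * (expKernel s u - 1 - (expKernel (s - h) u - 1)) =
          (1 - expKernel (-h) u) * ((levyWeight u)⁻¹ * expKernel s u) := fun u => by
        rw [sub_eq_add_neg s, expKernel_add]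
        ring
      simp only [h2]
      rw [← hdens h hh _ _ hZ, hcons h hh, hdens 1 h1nn _ _ hZ]
      refine setIntegral_congr_fun hZ fun u hu => ?_
      change levyWeight u * _ = _
      rw [← mul_assoc, mul_inv_cancel₀ (levyWeight_pos hu).ne', one_mul]
    have h3 := integral_add_compl (μ := (ρ h : Measure (Fin n → ℝ≥0)))
      (measurableSet_singleton 0) (integrable_expKernel (le_zero_of_mem_negOrthant hs) _)
    rw [hρ h hh s hs, integral_singleton, expKernel_zero_right, smul_eq_mul, mul_one] at h3
    simp only [backDiff] at h3 ⊢
    linarith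
  obtain ⟨c₀, c₁, hc⟩ := exists_affine_of_backDiff_eq
    (fun h _ => measureReal_nonneg) hcomp
  refine ⟨⟨c₀, c₁, μ⟩, ?_, fun s hs =>
    ⟨integrable_expKernel_sub_one hμW (le_zero_of_mem_negOrthant hs), ?_⟩⟩
  · refine withDensity_absolutelyContinuous _ _ ?_
    rw [Measure.restrict_apply (measurableSet_singleton 0)]
    simp [Z]
  · have := hc s hs
    change ψ s = c₀ + ∑ j, (c₁ j : ℝ) * s j + ∫ u, (expKernel s u - 1) ∂μ
    linarith

end BochnerPhillips

namespace BochnerPhillips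

/-! ### The Laplace transform of `ν_t` on the complex half-spaces -/

variable {n : ℕ}

/-- The exponential `u ↦ e^{z·u}` on `ℝ₊ⁿ` for complex `z`. -/
noncomputable def cexpKernel (z : Fin n → ℂ) (u : Fin n → ℝ≥0) : ℂ :=
  Complex.exp (∑ j, z j * ((u j : ℝ) : ℂ))

@[fun_prop]
theorem continuous_cexpKernel (z : Fin n → ℂ) : Continuous (cexpKernel z) := by
  unfold cexpKernel
  fun_prop

theorem norm_cexpKernel (z : Fin n → ℂ) (u : Fin n → ℝ≥0) :
    ‖cexpKernel z u‖ = expKernel (fun j => (z j).re) u := by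
  simp [cexpKernel, expKernel, Complex.norm_exp]

theorem norm_cexpKernel_le_one {z : Fin n → ℂ} (hz : ∀ j, (z j).re ≤ 0) (u : Fin n → ℝ≥0) :
    ‖cexpKernel z u‖ ≤ 1 := by
  rw [norm_cexpKernel]
  exact expKernel_le_one hz u

theorem integrable_cexpKernel {z : Fin n → ℂ} (hz : ∀ j, (z j).re ≤ 0)
    (ν : Measure (Fin n → ℝ≥0)) [IsFiniteMeasure ν] : Integrable (cexpKernel z) ν :=
  Integrable.of_bound (continuous_cexpKernel z).aestronglyMeasurable 1
    (Eventually.of_forall (norm_cexpKernel_le_one hz))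

theorem cexpKernel_ofReal (s : Fin n → ℝ) (u : Fin n → ℝ≥0) :
    cexpKernel (fun j => (s j : ℂ)) u = (expKernel s u : ℂ) := by
  simp [cexpKernel, expKernel]

theorem norm_exp_sub_one_le_norm {w : ℂ} (hw : w.re ≤ 0) : ‖Complex.exp w - 1‖ ≤ ‖w‖ := by
  have := (convex_halfSpace_re_le 0).norm_image_sub_le_of_norm_deriv_le (f := Complex.exp) (C := 1)
    (fun x _ => Complex.differentiableAt_exp) (fun x hx => by
      rw [Complex.deriv_exp, Complex.norm_exp]
      exact Real.exp_le_one_iff.2 hx) (x := 0) (y := w) (by simp) hw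
  simpa using this

/-- Domination by the weight, uniformly for bounded `z`. -/
theorem norm_cexpKernel_sub_one_le {z : Fin n → ℂ} (hz : ∀ j, (z j).re ≤ 0) {C : ℝ}
    (hC : ∑ j, ‖z j‖ ≤ C) (u : Fin n → ℝ≥0) :
    ‖cexpKernel z u - 1‖ ≤ (2 + C) * levyWeight u := by
  have hC0 : 0 ≤ C := (Finset.sum_nonneg fun j _ => norm_nonneg _).trans hC
  refine le_levyWeight zero_le_two hC0 ?_ ?_
  · refine (norm_sub_le _ _).trans ?_
    rw [norm_one]
    linarith [norm_cexpKernel_le_one hz u]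
  · have hre : (∑ j, z j * ((u j : ℝ) : ℂ)).re ≤ 0 := by
      rw [Complex.re_sum]
      refine Finset.sum_nonpos fun j _ => ?_
      rw [Complex.re_mul_ofReal]
      exact mul_nonpos_of_nonpos_of_nonneg (hz j) (u j).2
    refine (norm_exp_sub_one_le_norm hre).trans ((norm_sum_le _ _).trans ?_)
    refine le_trans ?_ (mul_le_mul_of_nonneg_right hC (Finset.sum_nonneg fun j _ => (u j).2))
    rw [Finset.sum_mul]
    refine Finset.sum_le_sum fun j _ => ?_
    rw [norm_mul, Complex.norm_real, Real.norm_of_nonneg (u j).coe_nonneg]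
    exact mul_le_mul_of_nonneg_left (Finset.single_le_sum (f := fun j => (u j : ℝ))
      (fun i _ => (u i).2) (Finset.mem_univ j)) (norm_nonneg _)

theorem integrable_cexpKernel_sub_one {μ : Measure (Fin n → ℝ≥0)} (hμ : Integrable levyWeight μ)
    {z : Fin n → ℂ} (hz : ∀ j, (z j).re ≤ 0) : Integrable (fun u => cexpKernel z u - 1) μ :=
  (hμ.const_mul (2 + ∑ j, ‖z j‖)).mono'
    ((continuous_cexpKernel z).sub continuous_const).aestronglyMeasurable
    (Eventually.of_forall (norm_cexpKernel_sub_one_le hz le_rfl))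

/-- The points of the complex line `w ↦ a + w b`. -/
def complexLine (a b : Fin n → ℝ) (w : ℂ) (j : Fin n) : ℂ := a j + w * b j

/-- The strip of those `w` for which `Re (a + w b)` lies in the negative orthant. -/
def lineStrip (a b : Fin n → ℝ) : Set ℂ := {w | ∀ j, a j + w.re * b j < 0}

theorem complexLine_re (a b : Fin n → ℝ) (w : ℂ) (j : Fin n) :
    (complexLine a b w j).re = a j + w.re * b j := by
  simp [complexLine]

theorem isOpen_lineStrip (a b : Fin n → ℝ) : IsOpen (lineStrip a b) := by
  have : lineStrip a b = ⋂ j, {w : ℂ | a j + w.re * b j < 0} := by ext; simp [lineStrip]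
  rw [this]
  exact isOpen_iInter_of_finite fun j => isOpen_lt (by fun_prop) continuous_const

theorem convex_lineStrip (a b : Fin n → ℝ) : Convex ℝ (lineStrip a b) := by
  intro v hv w hw p q hp hq hpq j
  have h1 := hv j
  have h2 := hw j
  have h3 : a j + (p • v + q • w).re * b j =
      p * (a j + v.re * b j) + q * (a j + w.re * b j) := by
    have : q = 1 - p := by linarith
    subst this
    simp
    ring
  rw [h3]
  rcases hp.eq_or_lt with rfl | hp
  · have : q = 1 := by linarith
    subst this
    linarith
  · nlinarith [mul_pos_of_neg_of_neg h1 (neg_neg_of_pos hp)]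

/-- Analyticity of the Lévy integral along complex lines. -/
theorem differentiableOn_integral_cexpKernel_sub_one {μ : Measure (Fin n → ℝ≥0)}
    (hμ : Integrable levyWeight μ) (a b : Fin n → ℝ) :
    DifferentiableOn ℂ (fun w => ∫ u, (cexpKernel (complexLine a b w) u - 1) ∂μ)
      (lineStrip a b) := by
  intro w₀ hw₀
  obtain ⟨κ, hκ, hκ0⟩ : ∃ κ : ℝ, (∀ j, a j + w₀.re * b j < -κ) ∧ 0 < κ := by
    have h1 : ∀ᶠ κ : ℝ in 𝓝[>] 0, ∀ j, a j + w₀.re * b j < -κ := by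
      rw [eventually_all]
      intro j
      have : Tendsto (fun κ : ℝ => -κ) (𝓝[>] 0) (𝓝 0) := by
        simpa using (tendsto_neg (0 : ℝ)).mono_left nhdsWithin_le_nhds
      exact this.eventually_const_lt (hw₀ j)
    exact (h1.and self_mem_nhdsWithin).exists
  have hs : {w : ℂ | ∀ j, a j + w.re * b j < -κ} ∈ 𝓝 w₀ := by
    have h1 : ∀ᶠ w : ℂ in 𝓝 w₀, ∀ j, a j + w.re * b j < -κ := by
      rw [eventually_all]
      intro j
      have : Continuous fun w : ℂ => a j + w.re * b j := by fun_prop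
      exact this.continuousAt.eventually_lt_const (hκ j)
    exact h1
  set B := ∑ j, |b j| with hB
  have hB0 : 0 ≤ B := Finset.sum_nonneg fun j _ => abs_nonneg _
  refine (hasDerivAt_integral_of_dominated_loc_of_deriv_le (μ := μ)
    (F' := fun w u => cexpKernel (complexLine a b w) u * ∑ j, (b j : ℂ) * ((u j : ℝ) : ℂ))
    (bound := fun u => (B / κ + B) * levyWeight u) hs
    (Eventually.of_forall fun w => ((continuous_cexpKernel _).sub
      continuous_const).aestronglyMeasurable)
    (integrable_cexpKernel_sub_one hμ fun j => by
      rw [complexLine_re]; exact (hw₀ j).le)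
    ((continuous_cexpKernel _).mul (by fun_prop)).aestronglyMeasurable ?_
    (hμ.const_mul _) ?_).2.differentiableAt.differentiableWithinAt
  · refine Eventually.of_forall fun u w hw => ?_
    set r := ∑ j, (u j : ℝ) with hr
    have hr0 : 0 ≤ r := Finset.sum_nonneg fun j _ => (u j).2
    have h1 : ‖∑ j, (b j : ℂ) * ((u j : ℝ) : ℂ)‖ ≤ B * r := by
      refine (norm_sum_le _ _).trans ?_
      rw [hB, Finset.sum_mul]
      refine Finset.sum_le_sum fun j _ => ?_
      rw [norm_mul, Complex.norm_real, Complex.norm_real, Real.norm_of_nonneg (u j).coe_nonneg,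
        Real.norm_eq_abs]
      exact mul_le_mul_of_nonneg_left (Finset.single_le_sum (f := fun j => (u j : ℝ))
        (fun i _ => (u i).2) (Finset.mem_univ j)) (abs_nonneg _)
    have h2 : ‖cexpKernel (complexLine a b w) u‖ ≤ Real.exp (-(κ * r)) := by
      rw [norm_cexpKernel, expKernel, Real.exp_le_exp, hr, Finset.mul_sum,
        ← Finset.sum_neg_distrib]
      refine Finset.sum_le_sum fun j _ => ?_
      rw [complexLine_re, ← neg_mul]
      exact mul_le_mul_of_nonneg_right (hw j).le (u j).2
    have h3 : Real.exp (-(κ * r)) ≤ 1 := Real.exp_le_one_iff.2 (by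
      have := mul_nonneg hκ0.le hr0
      linarith)
    have h4 : Real.exp (-(κ * r)) * r ≤ 1 / κ := by
      rw [le_div_iff₀ hκ0, Real.exp_neg, mul_assoc, mul_comm r κ, inv_mul_le_iff₀ (Real.exp_pos _),
        mul_one]
      linarith [Real.add_one_le_exp (κ * r)]
    have h5 := mul_le_mul h2 h1 (norm_nonneg _) (Real.exp_pos _).le
    rw [norm_mul]
    refine le_levyWeight (div_nonneg hB0 hκ0.le) hB0 (h5.trans ?_) (h5.trans ?_)
    · calc _ = B * (Real.exp (-(κ * r)) * r) := by ring
        _ ≤ B * (1 / κ) := mul_le_mul_of_nonneg_left h4 hB0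
        _ = _ := by ring
    · exact mul_le_of_le_one_left (mul_nonneg hB0 hr0) h3
  · refine Eventually.of_forall fun u w _ => HasDerivAt.sub_const _ ?_
    refine HasDerivAt.cexp (HasDerivAt.fun_sum fun j _ => ?_)
    refine HasDerivAt.mul_const ?_ _
    have := ((hasDerivAt_id w).mul_const (b j : ℂ)).const_add (a j : ℂ)
    simpa [complexLine] using this

theorem integrable_levyWeight_of_isFiniteMeasure (ν : Measure (Fin n → ℝ≥0)) [IsFiniteMeasure ν] :
    Integrable levyWeight ν :=
  (integrable_const 1).sub
    (integrable_expKernel (le_zero_of_mem_negOrthant neg_one_mem_negOrthant) ν)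

section Bernstein

variable {ψ : (Fin n → ℝ) → ℝ}

theorem IsBernstein.represents (hψ : IsBernstein ψ) : (levyData ψ).Represents ψ :=
  Classical.epsilon_spec hψ.exists_represents

theorem IsBernstein.integrable_levyWeight (hψ : IsBernstein ψ) :
    Integrable levyWeight (levyData ψ).μ := by
  have := ((hψ.represents.2 _ neg_one_mem_negOrthant).1).neg
  refine this.congr (Eventually.of_forall fun u => ?_)
  simp [levyWeight, expKernel]

theorem bernsteinExtend_eq (ψ : (Fin n → ℝ) → ℝ) (z : Fin n → ℂ) : bernsteinExtend ψ z =
    ((levyData ψ).c₀ : ℂ) + ∑ j, (((levyData ψ).c₁ j : ℝ) : ℂ) * z j +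
      ∫ u, (cexpKernel z u - 1) ∂(levyData ψ).μ := rfl

theorem IsBernstein.bernsteinExtend_ofReal (hψ : IsBernstein ψ) {s : Fin n → ℝ}
    (hs : s ∈ negOrthant n) : bernsteinExtend ψ (fun j => (s j : ℂ)) = ψ s := by
  have h1 : ∫ u, (cexpKernel (fun j => (s j : ℂ)) u - 1) ∂(levyData ψ).μ =
      ((∫ u, (expKernel s u - 1) ∂(levyData ψ).μ : ℝ) : ℂ) := by
    rw [← integral_complex_ofReal]
    simp [cexpKernel_ofReal]
  rw [bernsteinExtend_eq, h1, (hψ.represents.2 s hs).2]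
  push_cast
  rfl

/-- The formula `∫ e^{z·u} dν_t(u) = e^{tψ(z)}` inside the half-spaces: both sides are analytic
along the complex line `w ↦ Re z + w Im z`, and they agree for real `w`. -/
theorem IsBernstein.integral_cexpKernel_of_neg (hψ : IsBernstein ψ) (t : ℝ≥0) {z : Fin n → ℂ}
    (hz : ∀ j, (z j).re < 0) :
    ∫ u, cexpKernel z u ∂(subordinator ψ t : Measure (Fin n → ℝ≥0)) =
      Complex.exp ((t : ℝ) * bernsteinExtend ψ z) := by
  let a : Fin n → ℝ := fun j => (z j).re
  let b : Fin n → ℝ := fun j => (z j).im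
  set ν := (subordinator ψ t : Measure (Fin n → ℝ≥0))
  have hre : ∀ w ∈ lineStrip a b, ∀ j, (complexLine a b w j).re ≤ 0 := fun w hw j => by
    rw [complexLine_re]; exact (hw j).le
  have h1 : DifferentiableOn ℂ (fun w => ∫ u, cexpKernel (complexLine a b w) u ∂ν)
      (lineStrip a b) := by
    refine ((differentiableOn_integral_cexpKernel_sub_one
      (integrable_levyWeight_of_isFiniteMeasure ν) a b).add_const
      (ν.real Set.univ : ℂ)).congr fun w hw => ?_
    rw [integral_sub (integrable_cexpKernel (hre w hw) ν) (integrable_const 1)]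
    simp
  have h2 : DifferentiableOn ℂ
      (fun w => Complex.exp ((t : ℝ) * bernsteinExtend ψ (complexLine a b w)))
      (lineStrip a b) := by
    simp only [bernsteinExtend_eq]
    refine (((DifferentiableOn.const_add _ (DifferentiableOn.fun_sum fun j _ => ?_)).add
      (differentiableOn_integral_cexpKernel_sub_one hψ.integrable_levyWeight a b)).const_mul
      _).cexp
    unfold complexLine
    fun_prop
  have h0 : (0 : ℂ) ∈ lineStrip a b := fun j => by simpa [a] using hz j
  have hreal : ∃ᶠ w in 𝓝[≠] (0 : ℂ), ∫ u, cexpKernel (complexLine a b w) u ∂ν =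
      Complex.exp ((t : ℝ) * bernsteinExtend ψ (complexLine a b w)) := by
    have h3 : Tendsto (fun x : ℝ => (x : ℂ)) (𝓝[≠] 0) (𝓝[≠] 0) := by
      refine tendsto_nhdsWithin_iff.2 ⟨?_, ?_⟩
      · simpa using (Complex.continuous_ofReal.tendsto 0).mono_left nhdsWithin_le_nhds
      · filter_upwards [self_mem_nhdsWithin] with x hx
        simpa using hx
    refine h3.frequently (Eventually.frequently ?_)
    filter_upwards [h3.eventually (nhdsWithin_le_nhds ((isOpen_lineStrip a b).mem_nhds h0))]
      with x hx
    have hs : (fun j => a j + x * b j) ∈ negOrthant n := fun j => by simpa using hx j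
    have h4 : complexLine a b x = fun j => ((a j + x * b j : ℝ) : ℂ) := by
      ext j; simp [complexLine]
    rw [h4, hψ.bernsteinExtend_ofReal hs]
    simp only [cexpKernel_ofReal]
    rw [integral_complex_ofReal, hψ.integral_subordinator t hs]
    push_cast
    rfl
  have hI : Complex.I ∈ lineStrip a b := fun j => by simpa [a] using hz j
  have h5 := (h1.analyticOnNhd (isOpen_lineStrip a b)).eqOn_of_preconnected_of_frequently_eq
    (h2.analyticOnNhd (isOpen_lineStrip a b)) (convex_lineStrip a b).isPreconnected h0 hreal hI
  have h6 : complexLine a b Complex.I = z := by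
    ext j
    simp only [complexLine, a, b]
    rw [mul_comm]
    exact Complex.re_add_im (z j)
  simpa only [h6] using h5

/-- The formula `∫ e^{z·u} dν_t(u) = e^{tψ(z)}` for `Re z_j ≤ 0`, as a limit of the
formula for `Re z_j < 0`. -/
theorem IsBernstein.integral_cexpKernel (hψ : IsBernstein ψ) (t : ℝ≥0) {z : Fin n → ℂ}
    (hz : ∀ j, (z j).re ≤ 0) :
    ∫ u, cexpKernel z u ∂(subordinator ψ t : Measure (Fin n → ℝ≥0)) =
      Complex.exp ((t : ℝ) * bernsteinExtend ψ z) := by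
  let ε : ℕ → ℝ := fun m => 1 / ((m : ℝ) + 1)
  have hε0 : ∀ m, 0 < ε m := fun m => by positivity
  have hε1 : ∀ m, ε m ≤ 1 := fun m => div_le_one_of_le₀ (by simp) (by positivity)
  have hε : Tendsto (fun m => (ε m : ℂ)) atTop (𝓝 0) := by
    have := (Complex.continuous_ofReal.tendsto 0).comp
      (tendsto_one_div_add_atTop_nhds_zero_nat (𝕜 := ℝ))
    rwa [Complex.ofReal_zero] at this
  let y : ℕ → Fin n → ℂ := fun m j => z j - ε m
  have hy : ∀ m j, (y m j).re < 0 := fun m j => by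
    have := hε0 m
    have := hz j
    simp only [y, Complex.sub_re, Complex.ofReal_re]
    linarith
  have hyz : ∀ j, Tendsto (fun m => y m j) atTop (𝓝 (z j)) := fun j => by
    simpa using hε.const_sub (z j)
  have hK : ∀ u, Tendsto (fun m => cexpKernel (y m) u) atTop (𝓝 (cexpKernel z u)) := fun u =>
    (Complex.continuous_exp.tendsto _).comp
      (tendsto_finsetSum _ fun j _ => (hyz j).mul_const _)
  have h1 : Tendsto (fun m => ∫ u, cexpKernel (y m) u
      ∂(subordinator ψ t : Measure (Fin n → ℝ≥0))) atTop
      (𝓝 (∫ u, cexpKernel z u ∂(subordinator ψ t : Measure (Fin n → ℝ≥0)))) :=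
    tendsto_integral_of_dominated_convergence (fun _ => 1)
      (fun m => (continuous_cexpKernel _).aestronglyMeasurable) (integrable_const 1)
      (fun m => Eventually.of_forall (norm_cexpKernel_le_one fun j => (hy m j).le))
      (Eventually.of_forall hK)
  have h2 : Tendsto (fun m => ∫ u, (cexpKernel (y m) u - 1) ∂(levyData ψ).μ) atTop
      (𝓝 (∫ u, (cexpKernel z u - 1) ∂(levyData ψ).μ)) := by
    refine tendsto_integral_of_dominated_convergence
      (fun u => (2 + ∑ j : Fin n, (‖z j‖ + 1)) * levyWeight u)
      (fun m => ((continuous_cexpKernel _).sub continuous_const).aestronglyMeasurable)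
      (hψ.integrable_levyWeight.const_mul _)
      (fun m => Eventually.of_forall (norm_cexpKernel_sub_one_le (fun j => (hy m j).le)
        (Finset.sum_le_sum fun j _ => ?_)))
      (Eventually.of_forall fun u => (hK u).sub_const 1)
    refine (norm_sub_le _ _).trans ?_
    rw [Complex.norm_real, Real.norm_of_nonneg (hε0 m).le]
    linarith [hε1 m]
  have h3 : Tendsto (fun m => Complex.exp ((t : ℝ) * bernsteinExtend ψ (y m))) atTop
      (𝓝 (Complex.exp ((t : ℝ) * bernsteinExtend ψ z))) := by
    simp only [bernsteinExtend_eq]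
    exact (Complex.continuous_exp.tendsto _).comp (((tendsto_const_nhds.add
      (tendsto_finsetSum _ fun j _ => (hyz j).const_mul _)).add h2).const_mul _)
  exact tendsto_nhds_unique h1
    (h3.congr fun m => (hψ.integral_cexpKernel_of_neg t (hy m)).symm)

end Bernstein

end BochnerPhillips

namespace BochnerPhillips

/-! ### Bounded `C₀`-semigroups and their generators -/

variable {X : Type*} [NormedAddCommGroup X] [NormedSpace ℂ X]

theorem mem_generatorGraph {G : ℝ≥0 → X →L[ℂ] X} {x y : X} : (x, y) ∈ generatorGraph G ↔
    Tendsto (fun t : ℝ≥0 => ((t : ℝ) : ℂ)⁻¹ • (G t x - x)) (𝓝[>] 0) (𝓝 y) := Iff.rfl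

theorem generator_graph (G : ℝ≥0 → X →L[ℂ] X) : (generator G).graph = generatorGraph G := by
  refine Submodule.toLinearPMap_graph_eq _ fun p hp h0 => ?_
  have h1 : Tendsto (fun t : ℝ≥0 => ((t : ℝ) : ℂ)⁻¹ • (G t p.1 - p.1)) (𝓝[>] 0) (𝓝 p.2) := hp
  simp only [h0, map_zero, sub_zero, smul_zero] at h1
  exact tendsto_nhds_unique h1 tendsto_const_nhds

theorem generator_apply_mem {G : ℝ≥0 → X →L[ℂ] X} (x : (generator G).domain) :
    ((x : X), generator G x) ∈ generatorGraph G :=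
  generator_graph G ▸ (generator G).mem_graph x

theorem exists_generator_eq {G : ℝ≥0 → X →L[ℂ] X} {x y : X} (h : (x, y) ∈ generatorGraph G) :
    ∃ hx : x ∈ (generator G).domain, generator G ⟨x, hx⟩ = y := by
  rw [← generator_graph, LinearPMap.mem_graph_iff] at h
  obtain ⟨x', hx', hy⟩ := h
  obtain ⟨x', hx⟩ := x'
  obtain rfl : x' = x := hx'
  exact ⟨hx, hy⟩

theorem tendsto_toNNReal_sub (r : ℝ) :
    Tendsto (fun s : ℝ => (s - r).toNNReal) (𝓝[>] r) (𝓝[>] 0) := by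
  refine tendsto_nhdsWithin_iff.2 ⟨?_, ?_⟩
  · have : Continuous fun s : ℝ => (s - r).toNNReal := by fun_prop
    have h := (this.tendsto r).mono_left (nhdsWithin_le_nhds (s := Set.Ioi r))
    simpa using h
  · filter_upwards [self_mem_nhdsWithin] with s hs
    exact Real.toNNReal_pos.2 (sub_pos.2 hs)

namespace BoundedC0Semigroup

variable (S : BoundedC0Semigroup X) {x y : X}

theorem apply_add (s t : ℝ≥0) (x : X) : S (s + t) x = S s (S t x) := by rw [S.map_add]; rfl

theorem continuous_toNNReal (x : X) : Continuous fun s : ℝ => S s.toNNReal x :=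
  (S.continuous_orbit x).comp continuous_real_toNNReal

/-- The orbit of a vector in the domain of the generator has a right derivative. -/
theorem hasDerivWithinAt (h : (x, y) ∈ generatorGraph S) {r : ℝ} (hr : 0 ≤ r) :
    HasDerivWithinAt (fun s : ℝ => S s.toNNReal x) (S r.toNNReal y) (Set.Ici r) r := by
  rw [← hasDerivWithinAt_Ioi_iff_Ici, hasDerivWithinAt_iff_tendsto_slope' (by simp)]
  have h1 := (((S r.toNNReal).continuous.tendsto y).comp (mem_generatorGraph.1 h)).comp
    (tendsto_toNNReal_sub r)
  refine h1.congr' ?_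
  filter_upwards [self_mem_nhdsWithin] with s hs
  have hsr : 0 ≤ s - r := sub_nonneg.2 (le_of_lt hs)
  have h2 : s.toNNReal = r.toNNReal + (s - r).toNNReal := by
    rw [← Real.toNNReal_add hr hsr, add_sub_cancel]
  simp only [Function.comp_apply, slope, vsub_eq_sub, h2, S.apply_add, map_smul, map_sub,
    Real.coe_toNNReal _ hsr]
  rw [← Complex.ofReal_inv, Complex.coe_smul]

theorem map_mem_generatorGraph (h : (x, y) ∈ generatorGraph S) (r : ℝ≥0) :
    (S r x, S r y) ∈ generatorGraph S := by
  refine (((S r).continuous.tendsto y).comp (mem_generatorGraph.1 h)).congr fun t => ?_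
  simp only [Function.comp_apply, map_smul, map_sub]
  rw [← S.apply_add, add_comm, S.apply_add]

/-- Approximate eigenvectors of the generator are approximate eigenvectors of the semigroup. -/
theorem exists_norm_sub_exp_smul_le (z : ℂ) (t : ℝ≥0) : ∃ C : ℝ, ∀ x y : X,
    (x, y) ∈ generatorGraph S → ‖S t x - Complex.exp (z * (t : ℝ)) • x‖ ≤ C * ‖y - z • x‖ := by
  obtain ⟨M, hM⟩ := S.bounded
  have hM0 : 0 ≤ M := (norm_nonneg _).trans (hM 0)
  refine ⟨‖Complex.exp (z * (t : ℝ))‖ * (Real.exp (‖z‖ * t) * M * t), fun x y h => ?_⟩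
  have hE : ∀ s : ℝ, HasDerivAt (fun s : ℝ => Complex.exp (-(z * s)))
      (Complex.exp (-(z * s)) * -z) s := fun s => by
    have := ((hasDerivAt_id s).ofReal_comp.const_mul z).neg.cexp
    simpa using! this
  -- mean value inequality for `s ↦ e^{-zs} S_s x`, whose derivative is `e^{-zs} S_s (y - z x)`
  have hb := norm_image_sub_le_of_norm_deriv_right_le_segment (a := 0) (b := (t : ℝ))
    (f := fun s : ℝ => Complex.exp (-(z * s)) • S s.toNNReal x)
    (f' := fun s : ℝ => Complex.exp (-(z * s)) • S s.toNNReal (y - z • x))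
    (C := Real.exp (‖z‖ * t) * (M * ‖y - z • x‖))
    ((by fun_prop : Continuous fun s : ℝ => Complex.exp (-(z * s))).smul
      (S.continuous_toNNReal x)).continuousOn
    (fun s hs => by
      refine ((hE s).hasDerivWithinAt.smul (S.hasDerivWithinAt h hs.1)).congr_deriv ?_
      simp only [map_sub, map_smul, smul_sub, smul_smul]
      rw [mul_neg, neg_smul]
      abel)
    (fun s hs => by
      rw [norm_smul]
      refine mul_le_mul ?_ ((S _).le_of_opNorm_le (hM _) _) (norm_nonneg _) (Real.exp_pos _).le
      rw [Complex.norm_exp, Real.exp_le_exp]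
      refine (Complex.re_le_norm _).trans ?_
      rw [norm_neg, norm_mul, Complex.norm_real, Real.norm_of_nonneg hs.1]
      exact mul_le_mul_of_nonneg_left hs.2.le (norm_nonneg _))
    t (Set.right_mem_Icc.2 t.2)
  simp only [Real.toNNReal_coe, Real.toNNReal_zero, S.map_zero, Complex.ofReal_zero, mul_zero,
    neg_zero, Complex.exp_zero, one_smul, one_apply_eq_self, sub_zero] at hb
  have h1 : S t x - Complex.exp (z * (t : ℝ)) • x = Complex.exp (z * (t : ℝ)) •
      (Complex.exp (-(z * (t : ℝ))) • S t x - x) := by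
    rw [smul_sub, smul_smul, ← Complex.exp_add, add_neg_cancel, Complex.exp_zero, one_smul]
  rw [h1, norm_smul, mul_assoc]
  refine mul_le_mul_of_nonneg_left (hb.trans (le_of_eq ?_)) (norm_nonneg _)
  ring

section Complete

variable [CompleteSpace X]

/-- Time averages of an orbit lie in the domain of the generator. -/
theorem integral_mem_generatorGraph (x : X) {τ : ℝ} (hτ : 0 ≤ τ) :
    (∫ s in (0 : ℝ)..τ, S s.toNNReal x, S τ.toNNReal x - x) ∈ generatorGraph S := by
  set Φ : ℝ → X := fun τ => ∫ s in (0 : ℝ)..τ, S s.toNNReal x with hΦ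
  have hc := S.continuous_toNNReal x
  have hder : ∀ a, HasDerivAt Φ (S a.toNNReal x) a := fun a =>
    intervalIntegral.integral_hasDerivAt_right (hc.intervalIntegrable _ _)
      (hc.stronglyMeasurableAtFilter _ _) hc.continuousAt
  have hΦ0 : Φ 0 = 0 := by simp [hΦ]
  have hshift : ∀ t : ℝ≥0, S t (Φ τ) = Φ (τ + t) - Φ t := by
    intro t
    have h1 : S t (Φ τ) = ∫ s in (0 : ℝ)..τ, S t (S s.toNNReal x) :=
      ((S t).intervalIntegral_comp_comm (hc.intervalIntegrable _ _)).symm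
    have h2 : ∫ s in (0 : ℝ)..τ, S t (S s.toNNReal x) =
        ∫ s in (0 : ℝ)..τ, S ((t : ℝ) + s).toNNReal x := by
      refine intervalIntegral.integral_congr fun s hs => ?_
      rw [Set.uIcc_of_le hτ] at hs
      rw [Real.toNNReal_add t.coe_nonneg hs.1, Real.toNNReal_coe, S.apply_add]
    rw [h1, h2, intervalIntegral.integral_comp_add_left (fun s => S s.toNNReal x), add_zero,
      add_comm (t : ℝ) τ]
    exact (intervalIntegral.integral_interval_sub_left (hc.intervalIntegrable _ _)
      (hc.intervalIntegrable _ _)).symm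
  have hcoe : Tendsto (fun t : ℝ≥0 => (t : ℝ)) (𝓝[>] 0) (𝓝[≠] 0) := by
    refine tendsto_nhdsWithin_iff.2 ⟨?_, ?_⟩
    · simpa using (NNReal.continuous_coe.tendsto 0).mono_left nhdsWithin_le_nhds
    · filter_upwards [self_mem_nhdsWithin] with t ht
      exact (NNReal.coe_pos.2 ht).ne'
  have h1 := ((hder τ).tendsto_slope_zero.comp hcoe).sub ((hder 0).tendsto_slope_zero.comp hcoe)
  rw [Real.toNNReal_zero, S.map_zero, one_apply_eq_self] at h1
  refine h1.congr fun t => ?_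
  change _ = ((t : ℝ) : ℂ)⁻¹ • (S t (Φ τ) - Φ τ)
  simp only [Function.comp_apply, zero_add, hΦ0, sub_zero, hshift]
  rw [← smul_sub, ← Complex.ofReal_inv, Complex.coe_smul]
  congr 1
  abel

theorem dense_domain_generator : Dense ((generator S).domain : Set X) := by
  intro x
  have hc := S.continuous_toNNReal x
  have hder : HasDerivAt (fun τ : ℝ => ∫ s in (0 : ℝ)..τ, S s.toNNReal x) (S (0 : ℝ).toNNReal x)
      0 := intervalIntegral.integral_hasDerivAt_right (hc.intervalIntegrable _ _)
      (hc.stronglyMeasurableAtFilter _ _) hc.continuousAt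
  have h1 := hder.tendsto_slope_zero.mono_left (nhdsWithin_mono 0
    (show Set.Ioi (0 : ℝ) ⊆ {0}ᶜ from fun a ha => ne_of_gt ha))
  rw [Real.toNNReal_zero, S.map_zero, one_apply_eq_self] at h1
  refine mem_closure_of_tendsto h1 ?_
  filter_upwards [self_mem_nhdsWithin] with τ hτ
  rw [zero_add, intervalIntegral.integral_same, sub_zero, ← Complex.coe_smul]
  exact (generator S).domain.smul_mem _
    (exists_generator_eq (S.integral_mem_generatorGraph x (le_of_lt hτ))).1

/-- A functional `φ` with `φ(Ax) = z φ(x)` on the domain of the generator `A` satisfies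
`φ(S_t x) = e^{zt} φ(x)`. -/
theorem apply_eq_exp_mul {φ : StrongDual ℂ X} {z : ℂ}
    (hφ : ∀ x : (generator S).domain, φ (generator S x) = z * φ x) (t : ℝ≥0) (x : X) :
    φ (S t x) = Complex.exp (z * (t : ℝ)) * φ x := by
  have hφ' : ∀ x y, (x, y) ∈ generatorGraph S → φ y = z * φ x := fun x y h => by
    obtain ⟨hx, rfl⟩ := exists_generator_eq h
    exact hφ ⟨x, hx⟩
  refine isClosed_property (p := fun x => φ (S t x) = Complex.exp (z * (t : ℝ)) * φ x)
    S.dense_domain_generator.denseRange_val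
    (isClosed_eq (by fun_prop) (by fun_prop)) (fun x => ?_) x
  have h := generator_apply_mem x
  set y := generator S x
  have hE : ∀ s : ℝ, HasDerivAt (fun s : ℝ => Complex.exp (-(z * s)))
      (Complex.exp (-(z * s)) * -z) s := fun s => by
    have := ((hasDerivAt_id s).ofReal_comp.const_mul z).neg.cexp
    simpa using! this
  -- `s ↦ e^{-zs} φ(S_s x)` has derivative zero
  have hb := norm_image_sub_le_of_norm_deriv_right_le_segment (a := 0) (b := (t : ℝ))
    (f := fun s : ℝ => Complex.exp (-(z * s)) * φ (S s.toNNReal x))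
    (f' := fun s : ℝ => 0) (C := 0)
    ((by fun_prop : Continuous fun s : ℝ => Complex.exp (-(z * s))).mul
      (φ.continuous.comp (S.continuous_toNNReal x))).continuousOn
    (fun s hs => by
      have h1 := (φ.restrictScalars ℝ).hasFDerivAt.comp_hasDerivWithinAt s
        (S.hasDerivWithinAt h hs.1)
      refine ((hE s).hasDerivWithinAt.mul h1).congr_deriv ?_
      have h2 := hφ' _ _ (S.map_mem_generatorGraph h s.toNNReal)
      simp only [ContinuousLinearMap.coe_restrictScalars', Function.comp_apply, h2]
      ring)
    (fun s hs => by simp)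
    t (Set.right_mem_Icc.2 t.2)
  simp only [Real.toNNReal_coe, Real.toNNReal_zero, S.map_zero, Complex.ofReal_zero, mul_zero,
    neg_zero, Complex.exp_zero, one_mul, one_apply_eq_self, sub_zero, zero_mul,
    norm_le_zero_iff, sub_eq_zero] at hb
  rw [← hb, ← mul_assoc, ← Complex.exp_add, add_neg_cancel, Complex.exp_zero, one_mul]

end Complete

end BoundedC0Semigroup

/-- Boundedness of the semigroups keeps the spectral points in the closed left half-plane. -/
theorem re_nonpos_of_norm_exp_le {z : ℂ} {M : ℝ}
    (h : ∀ t : ℝ≥0, ‖Complex.exp (z * (t : ℝ))‖ ≤ M) : z.re ≤ 0 := by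
  by_contra! hz
  have hM : 0 ≤ M := (norm_nonneg _).trans (h 0)
  have h1 := h ⟨M / z.re, div_nonneg hM hz.le⟩
  rw [Complex.norm_exp, Complex.re_mul_ofReal] at h1
  have h2 := Real.add_one_le_exp (z.re * (M / z.re))
  rw [mul_div_cancel₀ _ hz.ne'] at h2
  change Real.exp (z.re * (M / z.re)) ≤ M at h1
  rw [mul_div_cancel₀ _ hz.ne'] at h1
  linarith

/-! ### The operators `T(u)` on joint (approximate) eigenvectors -/

section Multi

variable {n : ℕ} (T : Fin n → BoundedC0Semigroup X) {z : Fin n → ℂ}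

theorem multiSemigroup_succ {n : ℕ} (T : Fin (n + 1) → BoundedC0Semigroup X)
    (u : Fin (n + 1) → ℝ≥0) : multiSemigroup T u =
      T 0 (u 0) * multiSemigroup (fun j => T j.succ) (fun j => u j.succ) := by
  simp [multiSemigroup, List.ofFn_succ]

theorem cexpKernel_succ {n : ℕ} (z : Fin (n + 1) → ℂ) (u : Fin (n + 1) → ℝ≥0) :
    cexpKernel z u = Complex.exp (z 0 * ((u 0 : ℝ) : ℂ)) *
      cexpKernel (fun j => z j.succ) (fun j => u j.succ) := by
  simp [cexpKernel, Fin.sum_univ_succ, Complex.exp_add]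

theorem multiSemigroup_zero : multiSemigroup T 0 = 1 := by
  simp [multiSemigroup, BoundedC0Semigroup.map_zero]

theorem multiSemigroup_add (hT : ∀ i j : Fin n, ∀ s t : ℝ≥0, Commute (T i s) (T j t))
    (u v : Fin n → ℝ≥0) : multiSemigroup T (u + v) = multiSemigroup T u * multiSemigroup T v := by
  induction n with
  | zero => simp [multiSemigroup]
  | succ n ih =>
    have h1 : Commute (T 0 (v 0)) (multiSemigroup (fun j => T j.succ) (fun j => u j.succ)) := by
      refine Commute.list_prod_right _ _ fun a ha => ?_
      obtain ⟨j, rfl⟩ := (List.mem_ofFn' _ _).1 ha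
      exact hT _ _ _ _
    have h2 := ih (fun j => T j.succ) (fun i j => hT _ _) (fun j => u j.succ) (fun j => v j.succ)
    rw [multiSemigroup_succ, multiSemigroup_succ T u, multiSemigroup_succ T v, Pi.add_apply,
      (T 0).map_add, show (fun j => (u + v) (Fin.succ j)) =
        (fun j => u j.succ) + fun j => v j.succ from rfl, h2, mul_assoc, mul_assoc,
      ← mul_assoc (T 0 (v 0)), h1.eq, mul_assoc]

variable {T}

theorem tendsto_multiSemigroup_sub_smul {x : ℕ → X}
    (h : ∀ j (t : ℝ≥0), Tendsto (fun m => T j t (x m) - Complex.exp (z j * (t : ℝ)) • x m)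
      atTop (𝓝 0)) (u : Fin n → ℝ≥0) :
    Tendsto (fun m => multiSemigroup T u (x m) - cexpKernel z u • x m) atTop (𝓝 0) := by
  induction n with
  | zero => simp [multiSemigroup, cexpKernel]
  | succ n ih =>
    have h1 := ih (T := fun j => T j.succ) (z := fun j => z j.succ) (fun j => h j.succ)
      (fun j => u j.succ)
    have h2 := ((((T 0 (u 0)).continuous.tendsto 0).comp h1).add ((h 0 (u 0)).const_smul
      (cexpKernel (fun j => z j.succ) (fun j => u j.succ))))
    rw [map_zero, smul_zero, add_zero] at h2
    refine h2.congr fun m => ?_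
    rw [multiSemigroup_succ, cexpKernel_succ]
    simp only [Function.comp_apply, map_sub, map_smul, smul_sub, smul_smul,
      mul_apply_eq_comp]
    rw [mul_comm (Complex.exp _)]
    abel

theorem apply_multiSemigroup {φ : StrongDual ℂ X}
    (h : ∀ j (t : ℝ≥0) x, φ (T j t x) = Complex.exp (z j * (t : ℝ)) * φ x) (u : Fin n → ℝ≥0)
    (x : X) : φ (multiSemigroup T u x) = cexpKernel z u * φ x := by
  induction n with
  | zero => simp [multiSemigroup, cexpKernel]
  | succ n ih =>
    rw [multiSemigroup_succ, cexpKernel_succ, mul_apply_eq_comp, h,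
      ih (T := fun j => T j.succ) (z := fun j => z j.succ) (fun j => h j.succ), mul_assoc]

end Multi

end BochnerPhillips

namespace BochnerPhillips

/-! ### The subordinate semigroup -/

section Subordinator

variable {n : ℕ} {ψ : (Fin n → ℝ) → ℝ}

theorem cexpKernel_zero_left (u : Fin n → ℝ≥0) : cexpKernel 0 u = 1 := by simp [cexpKernel]

/-- The total mass of `ν_t`, read off at `z = 0`, where `ψ` has the value `c₀`. -/
theorem IsBernstein.subordinator_real_univ (hψ : IsBernstein ψ) (t : ℝ≥0) :
    (subordinator ψ t : Measure (Fin n → ℝ≥0)).real Set.univ =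
      Real.exp (t * (levyData ψ).c₀) := by
  have h := hψ.integral_cexpKernel t (z := 0) fun j => le_rfl
  have h0 : bernsteinExtend ψ 0 = (levyData ψ).c₀ := by
    simp [bernsteinExtend_eq, cexpKernel_zero_left]
  simp only [cexpKernel_zero_left, integral_const, h0] at h
  rw [Complex.real_smul, mul_one] at h
  exact_mod_cast h

theorem IsBernstein.c₀_nonpos (hψ : IsBernstein ψ) : (levyData ψ).c₀ ≤ 0 := by
  set d := levyData ψ
  -- `c₀ = ψ(-0)`, the limit of the nonpositive numbers `ψ(-ε, …, -ε)`
  let s : ℕ → Fin n → ℝ := fun m _ => -(1 / ((m : ℝ) + 1))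
  have hs : ∀ m, s m ∈ negOrthant n := fun m j => neg_lt_zero.2 (by positivity)
  have hs0 : ∀ j, Tendsto (fun m => s m j) atTop (𝓝 0) := fun j => by
    simpa only [neg_zero] using (tendsto_one_div_add_atTop_nhds_zero_nat (𝕜 := ℝ)).neg
  have hI : Tendsto (fun m => ∫ u, (expKernel (s m) u - 1) ∂d.μ) atTop (𝓝 0) := by
    have h1 : Tendsto (fun m => ∫ u, (expKernel (s m) u - 1) ∂d.μ) atTop
        (𝓝 (∫ u, (expKernel 0 u - 1) ∂d.μ)) := by
      refine tendsto_integral_of_dominated_convergence levyWeight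
        (fun m => ((continuous_expKernel _).sub continuous_const).aestronglyMeasurable)
        hψ.integrable_levyWeight (fun m => Eventually.of_forall fun u => ?_)
        (Eventually.of_forall fun u => Tendsto.sub_const ?_ 1)
      · rw [Real.norm_eq_abs, abs_sub_comm, abs_of_nonneg
          (sub_nonneg.2 (expKernel_le_one (le_zero_of_mem_negOrthant (hs m)) u))]
        refine sub_le_sub_left (Real.exp_le_exp.2 (Finset.sum_le_sum fun j _ => ?_)) 1
        refine mul_le_mul_of_nonneg_right (neg_le_neg ?_) (u j).2
        exact div_le_one_of_le₀ (by simp) (by positivity)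
      · exact (Real.continuous_exp.tendsto _).comp
          (tendsto_finsetSum _ fun j _ => (hs0 j).mul_const _)
    simpa [expKernel_zero_left] using h1
  have h2 : Tendsto (fun m => ψ (s m)) atTop (𝓝 d.c₀) := by
    have h3 := (tendsto_const_nhds (x := d.c₀)).add (tendsto_finsetSum Finset.univ
      fun j _ => (hs0 j).const_mul (d.c₁ j : ℝ)) |>.add hI
    simp only [mul_zero, Finset.sum_const_zero, add_zero] at h3
    exact h3.congr fun m => ((hψ.represents.2 _ (hs m)).2).symm
  exact le_of_tendsto' h2 fun m => hψ.2.1 _ (hs m)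

theorem IsBernstein.subordinator_real_univ_le_one (hψ : IsBernstein ψ) (t : ℝ≥0) :
    (subordinator ψ t : Measure (Fin n → ℝ≥0)).real Set.univ ≤ 1 := by
  rw [hψ.subordinator_real_univ]
  exact Real.exp_le_one_iff.2 (mul_nonpos_of_nonneg_of_nonpos t.2 hψ.c₀_nonpos)

theorem IsBernstein.tendsto_subordinator_real_univ (hψ : IsBernstein ψ) :
    Tendsto (fun t : ℝ≥0 => (subordinator ψ t : Measure (Fin n → ℝ≥0)).real Set.univ)
      (𝓝 0) (𝓝 1) := by
  simp only [hψ.subordinator_real_univ]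
  have : Continuous fun t : ℝ≥0 => Real.exp (t * (levyData ψ).c₀) := by fun_prop
  simpa using this.tendsto 0

/-- The measures `ν_t` concentrate at `0` as `t → 0`. -/
theorem IsBernstein.tendsto_integral_levyWeight (hψ : IsBernstein ψ) :
    Tendsto (fun t : ℝ≥0 => ∫ u, levyWeight u ∂(subordinator ψ t : Measure (Fin n → ℝ≥0)))
      (𝓝 0) (𝓝 0) := by
  have h1 : ∀ t, ∫ u, levyWeight u ∂(subordinator ψ t : Measure (Fin n → ℝ≥0)) =
      (subordinator ψ t : Measure (Fin n → ℝ≥0)).real Set.univ - Real.exp (t * ψ (-1)) := by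
    intro t
    unfold levyWeight
    rw [integral_sub (integrable_const 1)
      (integrable_expKernel (le_zero_of_mem_negOrthant neg_one_mem_negOrthant) _),
      hψ.integral_subordinator t neg_one_mem_negOrthant]
    simp
  simp only [h1]
  have : Continuous fun t : ℝ≥0 => Real.exp (t * ψ (-1)) := by fun_prop
  simpa using hψ.tendsto_subordinator_real_univ.sub (this.tendsto 0)

theorem IsBernstein.subordinator_zero (hψ : IsBernstein ψ) :
    (subordinator ψ 0 : Measure (Fin n → ℝ≥0)) = Measure.dirac 0 := by
  refine ext_of_integral_expKernel fun s hs => ?_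
  rw [hψ.integral_subordinator 0 hs, integral_dirac, expKernel_zero_right]
  simp

theorem expKernel_add_right (s : Fin n → ℝ) (u v : Fin n → ℝ≥0) :
    expKernel s (u + v) = expKernel s u * expKernel s v := by
  simp [expKernel, ← Real.exp_add, ← Finset.sum_add_distrib, mul_add]

theorem IsBernstein.subordinator_add (hψ : IsBernstein ψ) (s t : ℝ≥0) :
    (subordinator ψ (s + t) : Measure (Fin n → ℝ≥0)) =
      (subordinator ψ s : Measure (Fin n → ℝ≥0)) ∗ (subordinator ψ t : Measure (Fin n → ℝ≥0)) := by
  refine ext_of_integral_expKernel fun a ha => ?_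
  rw [integral_conv (integrable_expKernel (le_zero_of_mem_negOrthant ha) _)]
  simp only [expKernel_add_right, integral_const_mul, integral_mul_const,
    hψ.integral_subordinator _ ha, ← Real.exp_add]
  push_cast
  ring_nf

end Subordinator

variable {X : Type*} [NormedAddCommGroup X] [NormedSpace ℂ X]
  {n : ℕ} {T : Fin n → BoundedC0Semigroup X} {ψ : (Fin n → ℝ) → ℝ}

theorem subordinateSemigroup_apply (t : ℝ≥0) (x : X) : subordinateSemigroup ψ T t x =
    ∫ u, multiSemigroup T u x ∂(subordinator ψ t : Measure (Fin n → ℝ≥0)) := rfl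

theorem norm_subordinateSemigroup_le (hψ : IsBernstein ψ) {M : ℝ} (hM0 : 0 ≤ M)
    (hM : ∀ u, ‖multiSemigroup T u‖ ≤ M) (t : ℝ≥0) : ‖subordinateSemigroup ψ T t‖ ≤ M := by
  refine ContinuousLinearMap.opNorm_le_bound _ hM0 fun x => ?_
  rw [subordinateSemigroup_apply]
  refine (norm_integral_le_of_norm_le_const (C := M * ‖x‖)
    (Eventually.of_forall fun u => (multiSemigroup T u).le_of_opNorm_le (hM u) x)).trans ?_
  exact mul_le_of_le_one_right (by positivity) (hψ.subordinator_real_univ_le_one t)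

theorem subordinateSemigroup_add [CompleteSpace X]
    (hT : ∀ i j : Fin n, ∀ s t : ℝ≥0, Commute (T i s) (T j t))
    (hψ : IsBernstein ψ) (s t : ℝ≥0) : subordinateSemigroup ψ T (s + t) =
      subordinateSemigroup ψ T s * subordinateSemigroup ψ T t := by
  obtain ⟨M, hM0, hM⟩ := multiSemigroup_bounded T
  ext x
  have hint : Integrable (fun u => multiSemigroup T u x)
      ((subordinator ψ s : Measure (Fin n → ℝ≥0)) ∗ (subordinator ψ t : Measure _)) :=
    Integrable.of_bound (multiSemigroup_continuous T x).aestronglyMeasurable (M * ‖x‖)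
      (Eventually.of_forall fun u => (multiSemigroup T u).le_of_opNorm_le (hM u) x)
  rw [mul_apply_eq_comp, subordinateSemigroup_apply, subordinateSemigroup_apply,
    subordinateSemigroup_apply, hψ.subordinator_add, integral_conv hint]
  refine integral_congr_ae (Eventually.of_forall fun u => ?_)
  simp only [multiSemigroup_add T hT, mul_apply_eq_comp]
  exact (multiSemigroup T u).integral_comp_comm (multiSemigroup_integrable T _ x)

/-- `T(u)x` is close to `x` except where the weight `1 - e^{-|u|}` is bounded from below. -/
theorem exists_norm_multiSemigroup_sub_le (T : Fin n → BoundedC0Semigroup X) (x : X) {ε : ℝ}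
    (hε : 0 < ε) : ∃ C : ℝ, ∀ u, ‖multiSemigroup T u x - x‖ ≤ ε + C * levyWeight u := by
  obtain ⟨M, hM0, hM⟩ := multiSemigroup_bounded T
  have hcont := (multiSemigroup_continuous T x).tendsto 0
  rw [multiSemigroup_zero, one_apply_eq_self] at hcont
  obtain ⟨δ, hδ, hball⟩ := Metric.eventually_nhds_iff.1
    (hcont.eventually (Metric.ball_mem_nhds x hε))
  set c := 1 - Real.exp (-δ) with hc
  have hc0 : 0 < c := sub_pos.2 (Real.exp_lt_one_iff.2 (neg_lt_zero.2 hδ))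
  have hK0 : 0 ≤ M * ‖x‖ + ‖x‖ := by positivity
  refine ⟨(M * ‖x‖ + ‖x‖) / c, fun u => ?_⟩
  by_cases hu : dist u 0 < δ
  · have := hball hu
    rw [dist_eq_norm] at this
    exact this.le.trans (le_add_of_nonneg_right
      (mul_nonneg (div_nonneg hK0 hc0.le) (levyWeight_nonneg u)))
  · have h1 : δ ≤ ∑ j, (u j : ℝ) := by
      rw [dist_pi_lt_iff hδ] at hu
      push Not at hu
      obtain ⟨j, hj⟩ := hu
      have h2 : dist (u j) ((0 : Fin n → ℝ≥0) j) = u j := by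
        simp [NNReal.dist_eq]
      rw [h2] at hj
      exact hj.trans (Finset.single_le_sum (f := fun j => (u j : ℝ))
        (fun i _ => (u i).2) (Finset.mem_univ j))
    have h2 : c ≤ levyWeight u := by
      refine sub_le_sub_left (Real.exp_le_exp.2 ?_) 1
      simpa using h1
    have h3 : ‖multiSemigroup T u x - x‖ ≤ M * ‖x‖ + ‖x‖ :=
      (norm_sub_le _ _).trans (by gcongr; exact (multiSemigroup T u).le_of_opNorm_le (hM u) x)
    calc _ ≤ M * ‖x‖ + ‖x‖ := h3
      _ = (M * ‖x‖ + ‖x‖) / c * c := (div_mul_cancel₀ _ hc0.ne').symm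
      _ ≤ (M * ‖x‖ + ‖x‖) / c * levyWeight u :=
        mul_le_mul_of_nonneg_left h2 (div_nonneg hK0 hc0.le)
      _ ≤ _ := le_add_of_nonneg_left hε.le

theorem tendsto_subordinateSemigroup_zero [CompleteSpace X] (hψ : IsBernstein ψ) (x : X) :
    Tendsto (fun t => subordinateSemigroup ψ T t x) (𝓝 0) (𝓝 x) := by
  rw [tendsto_iff_norm_sub_tendsto_zero]
  refine Metric.tendsto_nhds.2 fun ε hε => ?_
  obtain ⟨C, hC⟩ := exists_norm_multiSemigroup_sub_le T x (half_pos hε)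
  have hlim : Tendsto (fun t : ℝ≥0 =>
      (ε / 2 * (subordinator ψ t : Measure (Fin n → ℝ≥0)).real Set.univ +
        C * ∫ u, levyWeight u ∂(subordinator ψ t : Measure (Fin n → ℝ≥0))) +
        |(subordinator ψ t : Measure (Fin n → ℝ≥0)).real Set.univ - 1| * ‖x‖) (𝓝 0)
      (𝓝 (ε / 2)) := by
    have h1 := (((hψ.tendsto_subordinator_real_univ.const_mul (ε / 2)).add
      (hψ.tendsto_integral_levyWeight.const_mul C)).add
      ((hψ.tendsto_subordinator_real_univ.sub_const 1).abs.mul_const ‖x‖))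
    simpa using h1
  filter_upwards [hlim.eventually_lt_const (half_lt_self hε)] with t ht
  rw [dist_zero_right, norm_norm]
  refine lt_of_le_of_lt ?_ ht
  set ν := (subordinator ψ t : Measure (Fin n → ℝ≥0))
  have h1 : subordinateSemigroup ψ T t x - x =
      ∫ u, (multiSemigroup T u x - x) ∂ν + (ν.real Set.univ - 1) • x := by
    rw [integral_sub (multiSemigroup_integrable T _ x) (integrable_const x), integral_const,
      sub_smul, one_smul, subordinateSemigroup_apply]
    abel
  rw [h1]
  refine (norm_add_le _ _).trans (add_le_add ?_ (by rw [norm_smul, Real.norm_eq_abs]))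
  have hW := integrable_levyWeight_of_isFiniteMeasure ν
  refine (norm_integral_le_of_norm_le ((integrable_const (ε / 2)).add (hW.const_mul C))
    (Eventually.of_forall hC)).trans (le_of_eq ?_)
  simp only [Pi.add_apply]
  rw [integral_add (integrable_const _) (hW.const_mul C), integral_const, integral_const_mul,
    smul_eq_mul, mul_comm]

/-- The operators `g_t(A)` form a bounded `C₀`-semigroup. -/
noncomputable def subordinateC0Semigroup
    [CompleteSpace X] (hT : ∀ i j : Fin n, ∀ s t : ℝ≥0, Commute (T i s) (T j t))
    (hψ : IsBernstein ψ) :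
    BoundedC0Semigroup X where
  toFun := subordinateSemigroup ψ T
  map_zero := by
    ext x
    rw [subordinateSemigroup_apply, hψ.subordinator_zero,
      integral_dirac' _ _ (multiSemigroup_continuous T x).stronglyMeasurable, multiSemigroup_zero]
  map_add := subordinateSemigroup_add hT hψ
  bounded := by
    obtain ⟨M, hM0, hM⟩ := multiSemigroup_bounded T
    exact ⟨M, norm_subordinateSemigroup_le hψ hM0 hM⟩
  continuous_orbit x := by
    obtain ⟨M, hM0, hM⟩ := multiSemigroup_bounded T
    have hle : ∀ s t : ℝ≥0, s ≤ t → ‖subordinateSemigroup ψ T t x - subordinateSemigroup ψ T s x‖ ≤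
        M * ‖subordinateSemigroup ψ T (t - s) x - x‖ := by
      intro s t hst
      have h1 := subordinateSemigroup_add hT hψ s (t - s)
      rw [add_tsub_cancel_of_le hst] at h1
      rw [h1, mul_apply_eq_comp, ← map_sub]
      exact (subordinateSemigroup ψ T s).le_of_opNorm_le
        (norm_subordinateSemigroup_le hψ hM0 hM s) _
    refine continuous_iff_continuousAt.2 fun t => ?_
    rw [ContinuousAt, tendsto_iff_norm_sub_tendsto_zero]
    have h1 : Tendsto (fun s : ℝ≥0 => max s t - min s t) (𝓝 t) (𝓝 0) := by
      have : Continuous fun s : ℝ≥0 => max s t - min s t := by fun_prop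
      simpa using this.tendsto t
    have h2 := ((tendsto_iff_norm_sub_tendsto_zero.1
      ((tendsto_subordinateSemigroup_zero (T := T) hψ x).comp h1)).const_mul M)
    rw [mul_zero] at h2
    refine squeeze_zero (fun _ => norm_nonneg _) (fun s => ?_) h2
    rcases le_total s t with hst | hst
    · rw [norm_sub_rev]
      simpa [hst] using hle s t hst
    · simpa [hst] using hle t s hst

/-! ### Spectral inclusions for a single semigroup -/

/-- `(e^{βt} - 1)/t → β` as `t → +0`. -/
theorem tendsto_inv_mul_exp_sub_one (β : ℂ) :
    Tendsto (fun t : ℝ≥0 => ((t : ℝ) : ℂ)⁻¹ * (Complex.exp ((t : ℝ) * β) - 1)) (𝓝[>] 0) (𝓝 β) := by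
  have h1 : HasDerivAt (fun w : ℂ => Complex.exp (w * β)) β 0 := by
    simpa using ((hasDerivAt_id (0 : ℂ)).mul_const β).cexp
  have h2 : Tendsto (fun t : ℝ≥0 => ((t : ℝ) : ℂ)) (𝓝[>] 0) (𝓝[≠] 0) := by
    refine tendsto_nhdsWithin_iff.2 ⟨?_, ?_⟩
    · have : Continuous fun t : ℝ≥0 => ((t : ℝ) : ℂ) := by fun_prop
      simpa using (this.tendsto 0).mono_left nhdsWithin_le_nhds
    · filter_upwards [self_mem_nhdsWithin] with t ht
      simpa using (ne_of_gt ht : t ≠ 0)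
  simpa using! h1.tendsto_slope_zero.comp h2

theorem apply_generatorGraph_eq_mul {G : ℝ≥0 → X →L[ℂ] X} {φ : StrongDual ℂ X} {β : ℂ}
    (hφ : ∀ (t : ℝ≥0) x, φ (G t x) = Complex.exp ((t : ℝ) * β) * φ x) {x y : X}
    (h : (x, y) ∈ generatorGraph G) : φ y = β * φ x := by
  have h1 := (φ.continuous.tendsto y).comp (mem_generatorGraph.1 h)
  refine tendsto_nhds_unique h1 (((tendsto_inv_mul_exp_sub_one β).mul_const (φ x)).congr
    fun t => ?_)
  simp only [Function.comp_apply, map_smul, map_sub, hφ, smul_eq_mul]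
  ring

theorem mem_generatorGraph_of_eq_exp_smul {G : ℝ≥0 → X →L[ℂ] X} {β : ℂ} {x : X}
    (h : ∀ t : ℝ≥0, G t x = Complex.exp ((t : ℝ) * β) • x) : (x, β • x) ∈ generatorGraph G := by
  refine ((tendsto_inv_mul_exp_sub_one β).smul_const x).congr fun t => ?_
  rw [h, mul_smul, sub_smul, one_smul]

/-- Common approximate eigenvectors `x_m` of the operators `S_t` yield approximate eigenvectors of
the generator, namely the normalized time averages `∫₀^τ S_s x_m ds` for a small `τ`. -/
theorem mem_approxSpectrum_generator [CompleteSpace X] (S : BoundedC0Semigroup X) {β : ℂ}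
    {x : ℕ → X} (hx : ∀ m, ‖x m‖ = 1)
    (h : ∀ t : ℝ≥0, Tendsto (fun m => S t (x m) - Complex.exp ((t : ℝ) * β) • x m) atTop (𝓝 0)) :
    β ∈ approxSpectrum (generator S) := by
  obtain ⟨M, hM⟩ := S.bounded
  have hexp : Continuous fun s : ℝ => Complex.exp ((s : ℂ) * β) := by fun_prop
  -- a `τ` for which the time average of the limit multipliers `e^{βs}` does not vanish
  obtain ⟨τ, hτ, hc⟩ : ∃ τ : ℝ, 0 < τ ∧ ∫ s in (0 : ℝ)..τ, Complex.exp ((s : ℂ) * β) ≠ 0 := by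
    have hder : HasDerivAt (fun τ : ℝ => ∫ s in (0 : ℝ)..τ, Complex.exp ((s : ℂ) * β))
        (Complex.exp (((0 : ℝ) : ℂ) * β)) 0 :=
      intervalIntegral.integral_hasDerivAt_right (hexp.intervalIntegrable _ _)
        (hexp.stronglyMeasurableAtFilter _ _) hexp.continuousAt
    have h1 := hder.tendsto_slope_zero.mono_left (nhdsWithin_mono 0
      (show Set.Ioi (0 : ℝ) ⊆ {0}ᶜ from fun a ha => ne_of_gt ha))
    rw [Complex.ofReal_zero, zero_mul, Complex.exp_zero] at h1
    obtain ⟨τ, h2, hτ⟩ := ((h1.eventually_ne one_ne_zero).and self_mem_nhdsWithin).exists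
    refine ⟨τ, hτ, fun h3 => h2 ?_⟩
    rw [zero_add, h3, intervalIntegral.integral_same, sub_zero, smul_zero]
  set c := ∫ s in (0 : ℝ)..τ, Complex.exp ((s : ℂ) * β) with hcdef
  have hβc : β * c = Complex.exp ((τ : ℂ) * β) - 1 := by
    have hd : ∀ s : ℝ, HasDerivAt (fun s : ℝ => Complex.exp ((s : ℂ) * β))
        (β * Complex.exp ((s : ℂ) * β)) s := fun s => by
      have := ((hasDerivAt_id s).ofReal_comp.mul_const β).cexp
      simpa [mul_comm] using! this
    have h1 := intervalIntegral.integral_eq_sub_of_hasDerivAt (a := 0) (b := τ)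
      (fun s _ => hd s) ((continuous_const.mul hexp).intervalIntegrable _ _)
    rw [intervalIntegral.integral_const_mul] at h1
    simpa using h1
  let y : ℕ → X := fun m => ∫ s in (0 : ℝ)..τ, S s.toNNReal (x m)
  have hgen : ∀ m, (y m, S τ.toNNReal (x m) - x m) ∈ generatorGraph S := fun m =>
    S.integral_mem_generatorGraph (x m) hτ.le
  have hsc : ∀ m, Continuous fun s : ℝ => S s.toNNReal (x m) := fun m =>
    S.continuous_toNNReal (x m)
  -- the averages are close to `c x_m`
  have hy : Tendsto (fun m => y m - c • x m) atTop (𝓝 0) := by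
    have h1 : ∀ m, y m - c • x m = ∫ s in (0 : ℝ)..τ,
        (S s.toNNReal (x m) - Complex.exp ((s : ℂ) * β) • x m) := fun m => by
      have h2 : Continuous fun s : ℝ => Complex.exp ((s : ℂ) * β) • x m :=
        hexp.smul continuous_const
      rw [intervalIntegral.integral_sub ((hsc m).intervalIntegrable _ _)
        (h2.intervalIntegrable _ _),
        intervalIntegral.integral_smul_const]
    simp only [h1]
    have h2 := intervalIntegral.tendsto_integral_filter_of_dominated_convergence
      (μ := volume) (a := (0 : ℝ)) (b := τ) (l := atTop)
      (F := fun (m : ℕ) (s : ℝ) => S s.toNNReal (x m) - Complex.exp ((s : ℂ) * β) • x m)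
      (f := fun _ => (0 : X)) (fun s : ℝ => M + ‖Complex.exp ((s : ℂ) * β)‖)
      (Eventually.of_forall fun m =>
        ((hsc m).sub (hexp.smul continuous_const)).aestronglyMeasurable)
      (Eventually.of_forall fun m => Eventually.of_forall fun s _ => by
        refine (norm_sub_le _ _).trans (add_le_add ?_ ?_)
        · simpa [hx m] using (S s.toNNReal).le_of_opNorm_le (hM _) (x m)
        · rw [norm_smul, hx m, mul_one])
      ((continuous_const.add hexp.norm).intervalIntegrable _ _)
      (Eventually.of_forall fun s hs => by
        rw [Set.uIoc_of_le hτ.le] at hs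
        simpa [Real.coe_toNNReal s hs.1.le] using h s.toNNReal)
    simpa using h2
  have hB : Tendsto (fun m => (S τ.toNNReal (x m) - x m) - β • y m) atTop (𝓝 0) := by
    have h1 := (h τ.toNNReal).sub (hy.const_smul β)
    rw [smul_zero, sub_zero] at h1
    refine h1.congr fun m => ?_
    rw [Real.coe_toNNReal τ hτ.le, smul_sub, smul_smul, hβc, sub_smul, one_smul]
    abel
  have hynorm : Tendsto (fun m => ‖y m‖) atTop (𝓝 ‖c‖) := by
    have h1 : Tendsto (fun m => ‖y m‖ - ‖c‖) atTop (𝓝 0) := by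
      refine squeeze_zero_norm (fun m => ?_) (tendsto_zero_iff_norm_tendsto_zero.1 hy)
      have := abs_norm_sub_norm_le (y m) (c • x m)
      rwa [norm_smul, hx m, mul_one] at this
    simpa using h1.add_const ‖c‖
  have hev : ∀ᶠ m in atTop, ‖y m‖ ≠ 0 := hynorm.eventually_ne (norm_ne_zero_iff.2 hc)
  obtain ⟨N, hN⟩ := eventually_atTop.1 hev
  have hmem : ∀ m, ((‖y (m + N)‖⁻¹ : ℂ) • y (m + N),
      (‖y (m + N)‖⁻¹ : ℂ) • (S τ.toNNReal (x (m + N)) - x (m + N))) ∈ generatorGraph S := fun m =>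
    (generatorGraph S).smul_mem _ (hgen (m + N))
  choose hdom happ using fun m => exists_generator_eq (hmem m)
  refine ⟨fun m => ⟨_, hdom m⟩, fun m => ?_, ?_⟩
  · have := hN (m + N) (Nat.le_add_left N m)
    change ‖(‖y (m + N)‖⁻¹ : ℂ) • y (m + N)‖ = 1
    rw [norm_smul, norm_inv, Complex.norm_real, norm_norm, inv_mul_cancel₀ this]
  · have h1 := ((hynorm.inv₀ (norm_ne_zero_iff.2 hc)).mul
      (tendsto_zero_iff_norm_tendsto_zero.1 hB))
    rw [mul_zero] at h1
    refine (h1.comp (tendsto_add_atTop_nat N)).congr fun m => ?_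
    simp only [Function.comp_apply, happ]
    rw [smul_comm β, ← smul_sub, norm_smul, norm_inv, Complex.norm_real, norm_norm]

theorem approxSpectrum_subset_opSpectrum (B : X →ₗ.[ℂ] X) : approxSpectrum B ⊆ opSpectrum B := by
  rintro α ⟨x, hx, hlim⟩ ⟨R, -, hR⟩
  have h1 : ∀ m, (1 : ℝ) ≤ ‖R‖ * ‖B (x m) - α • (x m : X)‖ := fun m => by
    have h2 := R.le_opNorm (α • (x m : X) - B (x m))
    rwa [hR, hx m, norm_sub_rev] at h2
  have h2 := hlim.const_mul ‖R‖
  rw [mul_zero] at h2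
  exact absurd (ge_of_tendsto' h2 h1) (by norm_num)

theorem residualSpectrum_subset_opSpectrum (B : X →ₗ.[ℂ] X) :
    residualSpectrum B ⊆ opSpectrum B := by
  rintro α hα ⟨R, hR, -⟩
  refine hα ?_
  have : (rangeSub B α : Set X) = Set.univ := Set.eq_univ_of_forall fun y => by
    obtain ⟨hy, h⟩ := hR y
    exact ⟨⟨R y, hy⟩, h⟩
  rw [this]
  exact dense_univ

/-! ### Functionals and the residual spectrum -/

theorem exists_dual_of_not_dense {p : Submodule ℂ X} (hp : ¬ Dense (p : Set X)) :
    ∃ φ : StrongDual ℂ X, φ ≠ 0 ∧ ∀ x ∈ p, φ x = 0 := by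
  obtain ⟨v, hv⟩ := not_forall.1 hp
  have hv' : v ∉ p.topologicalClosure := hv
  have hne : (p.topologicalClosure.mkQ v : X ⧸ p.topologicalClosure) ≠ 0 := by
    simpa using hv'
  have : IsClosed (p.topologicalClosure : Set X) := p.isClosed_topologicalClosure
  obtain ⟨g, -, hg⟩ := exists_dual_vector ℂ _ (norm_ne_zero_iff.2 hne)
  refine ⟨g.comp p.topologicalClosure.mkQL, fun h0 => ?_, fun x hx => ?_⟩
  · have h1 : g (p.topologicalClosure.mkQ v) = 0 :=
      congrArg (fun φ : StrongDual ℂ X => φ v) h0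
    rw [hg] at h1
    exact norm_ne_zero_iff.2 hne (RCLike.ofReal_eq_zero.1 h1)
  · have h1 : p.topologicalClosure.mkQ x = 0 := by
      simpa using p.le_topologicalClosure hx
    change g (p.topologicalClosure.mkQ x) = 0
    rw [h1, map_zero]

/-- `z` lies in the joint residual spectrum iff some functional `φ ≠ 0` satisfies
`φ(A_j x) = z_j φ(x)` for all `j`. -/
theorem mem_jointResidualSpectrum_iff {A : Fin n → X →ₗ.[ℂ] X} {z : Fin n → ℂ} :
    z ∈ jointResidualSpectrum A ↔ ∃ φ : StrongDual ℂ X, φ ≠ 0 ∧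
      ∀ j, ∀ x : (A j).domain, φ (A j x) = z j * φ x := by
  constructor
  · intro hz
    obtain ⟨φ, hφ, h0⟩ := exists_dual_of_not_dense hz
    refine ⟨φ, hφ, fun j x => ?_⟩
    have h1 := h0 _ ((le_iSup (fun j => rangeSub (A j) (z j)) j) ⟨x, rfl⟩)
    change φ (z j • (x : X) - A j x) = 0 at h1
    rw [map_sub, map_smul, smul_eq_mul, sub_eq_zero] at h1
    exact h1.symm
  · rintro ⟨φ, hφ, h⟩ hd
    have hle : (⨆ j, rangeSub (A j) (z j)) ≤ LinearMap.ker (φ : X →ₗ[ℂ] ℂ) := by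
      refine iSup_le fun j => ?_
      rintro _ ⟨x, rfl⟩
      change φ (z j • (x : X) - A j x) = 0
      rw [map_sub, map_smul, smul_eq_mul, h, sub_self]
    refine hφ (ContinuousLinearMap.ext fun x => ?_)
    exact isClosed_property (p := fun x => φ x = 0) hd.denseRange_val
      (isClosed_eq φ.continuous continuous_const) (fun x => hle x.2) x

theorem mem_residualSpectrum_of_dual {B : X →ₗ.[ℂ] X} {α : ℂ} {φ : StrongDual ℂ X} (hφ : φ ≠ 0)
    (h : ∀ x : B.domain, φ (B x) = α * φ x) : α ∈ residualSpectrum B := by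
  intro hd
  refine hφ (ContinuousLinearMap.ext fun x => ?_)
  refine isClosed_property (p := fun x => φ x = 0) hd.denseRange_val
    (isClosed_eq φ.continuous continuous_const) ?_ x
  rintro ⟨_, x, rfl⟩
  change φ (α • (x : X) - B x) = 0
  rw [map_sub, map_smul, smul_eq_mul, h, sub_self]

/-- For a densely defined operator, `dualOperator` acts as the adjoint. -/
theorem apply_of_dualOperator_eq {B : X →ₗ.[ℂ] X} (hB : Dense (B.domain : Set X))
    {f : StrongDual ℂ X} {z : ℂ} (hf : f ∈ (dualOperator B).domain)
    (h : dualOperator B ⟨f, hf⟩ = z • f) (x : B.domain) : f (B x) = z * f x := by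
  have hgraph : (dualOperator B).graph = dualGraph B := by
    refine Submodule.toLinearPMap_graph_eq _ fun p hp h0 => ?_
    have hp : ∀ x : B.domain, p.1 (B x) = p.2 (x : X) := hp
    refine ContinuousLinearMap.ext fun x => ?_
    refine isClosed_property (p := fun x => p.2 x = 0) hB.denseRange_val
      (isClosed_eq p.2.continuous continuous_const) (fun x => ?_) x
    rw [← hp x, h0]
    rfl
  have h1 := (dualOperator B).mem_graph ⟨f, hf⟩
  rw [hgraph, h] at h1
  exact h1 x

/-! ### Spectral mapping for the tuple of generators -/

theorem re_nonpos_of_dual {S : BoundedC0Semigroup X} {φ : StrongDual ℂ X} (hφ : φ ≠ 0) {z : ℂ}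
    (h : ∀ (t : ℝ≥0) x, φ (S t x) = Complex.exp (z * (t : ℝ)) * φ x) : z.re ≤ 0 := by
  obtain ⟨x, hx⟩ : ∃ x, φ x ≠ 0 := by
    by_contra! h0
    exact hφ (ContinuousLinearMap.ext h0)
  obtain ⟨M, hM⟩ := S.bounded
  refine re_nonpos_of_norm_exp_le (M := ‖φ‖ * (M * ‖x‖) / ‖φ x‖) fun t => ?_
  rw [le_div_iff₀ (norm_pos_iff.2 hx), ← norm_mul, ← h]
  exact (φ.le_opNorm _).trans
    (mul_le_mul_of_nonneg_left ((S t).le_of_opNorm_le (hM t) x) (norm_nonneg _))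

/-- A joint eigenfunctional of the generators is an eigenfunctional of `ψ(A)`. -/
theorem apply_bernsteinOperator [CompleteSpace X] (hψ : IsBernstein ψ)
    {φ : StrongDual ℂ X} (hφ : φ ≠ 0) {z : Fin n → ℂ}
    (h : ∀ j, ∀ x : (generators T j).domain, φ (generators T j x) = z j * φ x)
    (x : (bernsteinOperator ψ T).domain) :
    φ (bernsteinOperator ψ T x) = bernsteinExtend ψ z * φ x := by
  have h1 : ∀ j (t : ℝ≥0) x, φ (T j t x) = Complex.exp (z j * (t : ℝ)) * φ x := fun j =>
    (T j).apply_eq_exp_mul (h j)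
  have hz : ∀ j, (z j).re ≤ 0 := fun j => re_nonpos_of_dual hφ (h1 j)
  refine apply_generatorGraph_eq_mul (fun t x => ?_) (generator_apply_mem x)
  rw [subordinateSemigroup_apply, ← hψ.integral_cexpKernel t hz, ← integral_mul_const,
    ← φ.integral_comp_comm (multiSemigroup_integrable T _ x)]
  exact integral_congr_ae (Eventually.of_forall fun u => apply_multiSemigroup h1 u x)

theorem re_nonpos_of_approx {S : BoundedC0Semigroup X} {z : ℂ} {x : ℕ → X} (hx : ∀ m, ‖x m‖ = 1)
    (h : ∀ t : ℝ≥0, Tendsto (fun m => S t (x m) - Complex.exp (z * (t : ℝ)) • x m) atTop (𝓝 0)) :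
    z.re ≤ 0 := by
  obtain ⟨M, hM⟩ := S.bounded
  refine re_nonpos_of_norm_exp_le (M := M) fun t => ?_
  have h1 := (tendsto_zero_iff_norm_tendsto_zero.1 (h t)).const_add M
  rw [add_zero] at h1
  refine ge_of_tendsto' h1 fun m => ?_
  have h2 := norm_sub_norm_le (Complex.exp (z * (t : ℝ)) • x m) (S t (x m))
  have h3 := (S t).le_of_opNorm_le (hM t) (x m)
  rw [norm_smul, hx m, mul_one, norm_sub_rev] at h2
  rw [hx m, mul_one] at h3
  linarith

/-- Common approximate eigenvectors of the semigroups are approximate eigenvectors of the operators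
`g_t(A)`, by dominated convergence in `∫ (T(u)x_m - e^{z·u} x_m) dν_t(u)`. -/
theorem tendsto_subordinateSemigroup_sub [CompleteSpace X] (hψ : IsBernstein ψ)
    {z : Fin n → ℂ} {x : ℕ → X} (hx : ∀ m, ‖x m‖ = 1)
    (h : ∀ j (t : ℝ≥0), Tendsto (fun m => T j t (x m) - Complex.exp (z j * (t : ℝ)) • x m)
      atTop (𝓝 0)) (t : ℝ≥0) :
    Tendsto (fun m => subordinateSemigroup ψ T t (x m) -
      Complex.exp ((t : ℝ) * bernsteinExtend ψ z) • x m) atTop (𝓝 0) := by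
  obtain ⟨M, -, hM⟩ := multiSemigroup_bounded T
  have hz : ∀ j, (z j).re ≤ 0 := fun j => re_nonpos_of_approx hx (h j)
  have h1 : ∀ m, subordinateSemigroup ψ T t (x m) -
      Complex.exp ((t : ℝ) * bernsteinExtend ψ z) • x m =
      ∫ u, (multiSemigroup T u (x m) - cexpKernel z u • x m)
        ∂(subordinator ψ t : Measure (Fin n → ℝ≥0)) := fun m => by
    rw [subordinateSemigroup_apply, ← hψ.integral_cexpKernel t hz, ← integral_smul_const,
      ← integral_sub (multiSemigroup_integrable T _ (x m))
        ((integrable_cexpKernel hz _).smul_const (x m))]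
  simp only [h1]
  have h2 := tendsto_integral_of_dominated_convergence
    (μ := (subordinator ψ t : Measure (Fin n → ℝ≥0)))
    (F := fun m u => multiSemigroup T u (x m) - cexpKernel z u • x m) (f := fun _ => (0 : X))
    (fun _ => M + 1)
    (fun m => ((multiSemigroup_continuous T (x m)).sub
      ((continuous_cexpKernel z).smul continuous_const)).aestronglyMeasurable)
    (integrable_const _)
    (fun m => Eventually.of_forall fun u => by
      refine (norm_sub_le _ _).trans (add_le_add ?_ ?_)
      · simpa [hx m] using (multiSemigroup T u).le_of_opNorm_le (hM u) (x m)
      · rw [norm_smul, hx m, mul_one]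
        exact norm_cexpKernel_le_one hz u)
    (Eventually.of_forall fun u => tendsto_multiSemigroup_sub_smul h u)
  simpa using h2

theorem tendsto_semigroup_sub_of_generator {S : BoundedC0Semigroup X} {z : ℂ} {x : ℕ → X}
    (hdom : ∀ m, x m ∈ (generator S).domain)
    (h : Tendsto (fun m => ‖generator S ⟨x m, hdom m⟩ - z • x m‖) atTop (𝓝 0)) (t : ℝ≥0) :
    Tendsto (fun m => S t (x m) - Complex.exp (z * (t : ℝ)) • x m) atTop (𝓝 0) := by
  obtain ⟨C, hC⟩ := S.exists_norm_sub_exp_smul_le z t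
  have h1 := h.const_mul C
  rw [mul_zero] at h1
  exact squeeze_zero_norm (fun m => hC _ _ (generator_apply_mem ⟨x m, hdom m⟩)) h1

/-- `ψ` maps the joint residual spectrum of `A` into the residual spectrum of `ψ(A)`. -/
theorem bernsteinExtend_mem_residualSpectrum [CompleteSpace X] (hψ : IsBernstein ψ)
    {z : Fin n → ℂ} (hz : z ∈ jointResidualSpectrum (generators T)) :
    bernsteinExtend ψ z ∈ residualSpectrum (bernsteinOperator ψ T) := by
  obtain ⟨φ, hφ, h⟩ := mem_jointResidualSpectrum_iff.1 hz
  exact mem_residualSpectrum_of_dual hφ (apply_bernsteinOperator hψ hφ h)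

/-- `ψ` maps the joint point spectrum of `A` into the point spectrum of `ψ(A)`. -/
theorem bernsteinExtend_mem_pointSpectrum [CompleteSpace X] (hψ : IsBernstein ψ)
    {z : Fin n → ℂ} (hz : z ∈ jointPointSpectrum (generators T)) :
    bernsteinExtend ψ z ∈ pointSpectrum (bernsteinOperator ψ T) := by
  obtain ⟨x, hx, h⟩ := hz
  choose hdom hval using h
  have hx' : ‖x‖ ≠ 0 := norm_ne_zero_iff.2 hx
  have hconst : ∀ j (t : ℝ≥0), T j t x = Complex.exp (z j * (t : ℝ)) • x := fun j t => by
    obtain ⟨C, hC⟩ := (T j).exists_norm_sub_exp_smul_le (z j) t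
    have h1 := hC _ _ (generator_apply_mem ⟨x, hdom j⟩)
    rw [show generator (T j) ⟨x, hdom j⟩ = z j • x from hval j, sub_self, norm_zero, mul_zero] at h1
    exact sub_eq_zero.1 (norm_le_zero_iff.1 h1)
  have h1 : ∀ t : ℝ≥0, subordinateSemigroup ψ T t x =
      Complex.exp ((t : ℝ) * bernsteinExtend ψ z) • x := fun t => by
    -- the normalized eigenvector, as a constant sequence of approximate eigenvectors
    have h2 := tendsto_subordinateSemigroup_sub (T := T) hψ (z := z)
      (x := fun _ => (‖x‖⁻¹ : ℂ) • x)
      (fun _ => by rw [norm_smul, norm_inv, Complex.norm_real, norm_norm, inv_mul_cancel₀ hx'])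
      (fun j t => by simp [hconst j t, smul_comm (Complex.exp _)]) t
    have h3 := tendsto_nhds_unique tendsto_const_nhds h2
    rw [map_smul, smul_comm (Complex.exp _), ← smul_sub] at h3
    refine sub_eq_zero.1 ((smul_eq_zero.1 h3).resolve_left ?_)
    simpa using hx
  obtain ⟨hd, he⟩ := exists_generator_eq (mem_generatorGraph_of_eq_exp_smul h1)
  exact ⟨x, hx, hd, he⟩

/-- `ψ` maps the joint approximate spectrum of `A` into the approximate point spectrum of
`ψ(A)`. -/
theorem bernsteinExtend_mem_approxSpectrum [CompleteSpace X]
    (hT : ∀ i j : Fin n, ∀ s t : ℝ≥0, Commute (T i s) (T j t)) (hψ : IsBernstein ψ)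
    {z : Fin n → ℂ} (hz : z ∈ jointApproxSpectrum (generators T)) :
    bernsteinExtend ψ z ∈ approxSpectrum (bernsteinOperator ψ T) := by
  obtain ⟨x, hdom, hx, h⟩ := hz
  exact mem_approxSpectrum_generator (subordinateC0Semigroup hT hψ) hx
    (tendsto_subordinateSemigroup_sub hψ hx fun j =>
      tendsto_semigroup_sub_of_generator (fun m => hdom m j) (h j))

end BochnerPhillips

theorem mainTheorem1 {X : Type*} [NormedAddCommGroup X] [NormedSpace ℂ X] [CompleteSpace X]
    {n : ℕ} (T : Fin n → BoundedC0Semigroup X)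
    (hT : ∀ i j : Fin n, ∀ s t : ℝ≥0, Commute (T i s) (T j t))
    (ψ : (Fin n → ℝ) → ℝ) (hψ : IsBernstein ψ) :
    bernsteinExtend ψ '' jointResidualSpectrum (generators T) ⊆
        residualSpectrum (bernsteinOperator ψ T) ∧
      bernsteinExtend ψ '' jointPointSpectrum (generators T) ⊆
        pointSpectrum (bernsteinOperator ψ T) ∧
      {α : ℂ | ∃ (x : X) (z : Fin n → ℂ) (f : StrongDual ℂ X),
          IsEigenvector (bernsteinOperator ψ T) α x ∧
          IsJointEigenvector (fun j => dualOperator (generators T j)) z f ∧ f x ≠ 0} ⊆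
        bernsteinExtend ψ '' jointResidualSpectrum (generators T) ∧
      (((∀ j, approxSpectrum (generators T j) ⊆ {z : ℂ | z.re < 0}) ∨
          (∀ j, ∃ L : ℝ, Tendsto (partialDeriv j ψ) (𝓝[negOrthant n] 0) (𝓝 L))) →
        bernsteinExtend ψ '' jointApproxSpectrum (generators T) ⊆
            approxSpectrum (bernsteinOperator ψ T) ∧
          bernsteinExtend ψ '' jointSpectrum (generators T) ⊆
            opSpectrum (bernsteinOperator ψ T)) := by
  refine ⟨?_, ?_, ?_, fun _ => ⟨?_, ?_⟩⟩
  · rintro _ ⟨z, hz, rfl⟩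
    exact bernsteinExtend_mem_residualSpectrum hψ hz
  · rintro _ ⟨z, hz, rfl⟩
    exact bernsteinExtend_mem_pointSpectrum hψ hz
  · rintro α ⟨x, z, f, ⟨-, hx, hBx⟩, ⟨hf, hAf⟩, hfx⟩
    have h : ∀ j, ∀ x : (generators T j).domain, f (generators T j x) = z j * f x := fun j =>
      (hAf j).elim fun hdom hval =>
        apply_of_dualOperator_eq (T j).dense_domain_generator hdom hval
    refine ⟨z, mem_jointResidualSpectrum_iff.2 ⟨f, hf, h⟩, ?_⟩
    -- both `ψ(z)` and `α` describe the action of `f` on `ψ(A)x`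
    have h1 := apply_bernsteinOperator hψ hf h ⟨x, hx⟩
    rw [hBx, map_smul, smul_eq_mul] at h1
    exact (mul_right_cancel₀ hfx h1).symm
  · rintro _ ⟨z, hz, rfl⟩
    exact bernsteinExtend_mem_approxSpectrum hT hψ hz
  · rintro _ ⟨z, hz | hz, rfl⟩
    · exact approxSpectrum_subset_opSpectrum _ (bernsteinExtend_mem_approxSpectrum hT hψ hz)
    · exact residualSpectrum_subset_opSpectrum _ (bernsteinExtend_mem_residualSpectrum hψ hz)
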